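/- Let $n,q\ge 1$ be integers, $d=(d_1,\dots,d_q)\in\mathbb N^q$ with $D:=\max_i d_i\ge 1$, and for a $q$-tuple $f=(f_1,\dots,f_q)$ of real homogeneous polynomials in $X_0,\dots,X_n$ with $\deg f_i=d_i$ put $$\|f\|_\infty^{\mathbb R}:=\max_{x\in\mathbb S^n}\max_{1\le i\le q}|f_i(x)|,\qquad \mathbb S^n=\{x\in\mathbb R^{n+1}:\|x\|_2=1\}.$$ A real random variable $r$ is subgaussian if there is $K>0$ with $(\mathbb E|r|^p)^{1/p}\le K\sqrt p$ for all real $p\ge 1$; the smallest such $K$ is its $\psi_2$-norm. It has the anti-concentration property with constant $\rho$ if $\mathbb P(|r-u|<\varepsilon)\le 2\rho\varepsilon$ for all $u\in\mathbb R$ and $\varepsilon>0$. A random tuple $f$ is called dobro with parameters $K$ and $\rho$ if $$f_i=\sum_{|\alpha|=d_i}\binom{d_i}{\alpha}^{1/2}c_{i,\alpha}X^\alpha\qquad(1\le i\le q),$$ where $\binom{d_i}{\alpha}$ is the multinomial coefficient and all the $c_{i,\alpha}$ are (jointly) independent centered subgaussian random variables with $\psi_2$-norm at most $K$ and with the anti-concentration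 property with constant $\rho$. **Proposition 4.32.** Let $f$ be a dobro random polynomial tuple with parameters $K$ and $\rho$. Then for all $t>0$ $$\mathbb P\big(\|f\|_\infty^{\mathbb R}\ge t\big)\le q\,\sqrt{2\pi}\,\sqrt{n+1}\,\Big(\frac{eD}{2}\Big)^{n} e^{-\frac{t^2}{17K^2}}.$$ In particular, if $q\le n+1$, then for all real $\ell\ge 1$ the moment $\mathbb E\big(\|f\|_\infty^{\mathbb R}\big)^\ell$ is finite and $$\Big(\mathbb E\big(\|f\|_\infty^{\mathbb R}\big)^\ell\Big)^{1/\ell}\le 63\,K\sqrt{n\,\ln(eD)\,\ell}.$$ -/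

import Mathlib

open MeasureTheory ProbabilityTheory

noncomputable section

namespace Dobro

/-- The exponents `α = (α₀, …, αₙ) ∈ ℕⁿ⁺¹` with `|α| = α₀ + ⋯ + αₙ = e`. -/
def exponents (n e : ℕ) : Finset (Fin (n + 1) →₀ ℕ) :=
  Finset.univ.finsuppAntidiag e

/-- Tuples of `q` real homogeneous polynomials in the `n + 1` variables `X₀, …, Xₙ`, the `i`-th one
of degree `d i`. -/
abbrev HomogTuple (n : ℕ) {q : ℕ} (d : Fin q → ℕ) : Type :=
  (i : Fin q) → MvPolynomial.homogeneousSubmodule (Fin (n + 1)) ℝ (d i)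

/-- The largest degree `D = max {d₁, …, d_q}`. -/
def maxDegree {q : ℕ} (d : Fin q → ℕ) : ℕ := Finset.univ.sup d

/-- The value `f(x) = (f₁(x), …, f_q(x)) ∈ ℝ^q` at a point `x ∈ ℝⁿ⁺¹`. -/
def evalTuple {n q : ℕ} {d : Fin q → ℕ} (f : HomogTuple n d)
    (x : EuclideanSpace ℝ (Fin (n + 1))) : Fin q → ℝ :=
  fun i => MvPolynomial.eval (fun j => x j) (f i : MvPolynomial (Fin (n + 1)) ℝ)

/-- The real `L_∞`-norm: the maximum over the Euclidean unit sphere `𝕊ⁿ ⊆ ℝⁿ⁺¹` of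
`‖f(x)‖_∞ = max_i |f_i(x)|` (the norm of `Fin q → ℝ` is the maximum norm). -/
def supNorm {n q : ℕ} {d : Fin q → ℕ} (f : HomogTuple n d) : ℝ :=
  ⨆ x : Metric.sphere (0 : EuclideanSpace ℝ (Fin (n + 1))) 1, ‖evalTuple f x‖

variable {Ω : Type*} [MeasurableSpace Ω]

/-- `(𝔼 |r|^p)^{1/p} ≤ K √p` for all real `p ≥ 1` (in particular these moments are finite). -/
def MomentBound (P : Measure Ω) (r : Ω → ℝ) (K : ℝ) : Prop :=
  ∀ p : ℝ, 1 ≤ p → eLpNorm r (ENNReal.ofReal p) P ≤ ENNReal.ofReal (K * √p)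

/-- A random variable is subgaussian if its moments satisfy the bound for some `K > 0`. -/
def IsSubgaussian (P : Measure Ω) (r : Ω → ℝ) : Prop :=
  ∃ K : ℝ, 0 < K ∧ MomentBound P r K

/-- The `ψ₂`-norm of a subgaussian random variable: the best constant in the moment bound. -/
def psiTwoNorm (P : Measure Ω) (r : Ω → ℝ) : ℝ :=
  sInf {K : ℝ | 0 < K ∧ MomentBound P r K}

/-- The anti-concentration property with constant `ρ`. -/
def AntiConcentration (P : Measure Ω) (r : Ω → ℝ) (ρ : ℝ) : Prop :=
  ∀ u ε : ℝ, 0 < ε → P.real {ω | |r ω - u| < ε} ≤ 2 * ρ * ε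

/-- Dobro random polynomial tuples with parameters `K` and `ρ`:
`f_i = ∑_{|α| = d_i} (d_i choose α)^{1/2} c_{i,α} X^α`, where all the `c_{i,α}` are jointly
independent centered subgaussian random variables with `ψ₂`-norm at most `K` and with the
anti-concentration property with constant `ρ`. -/
def IsDobro (P : Measure Ω) {n q : ℕ} {d : Fin q → ℕ} (f : Ω → HomogTuple n d) (K ρ : ℝ) : Prop :=
  ∃ c : (Σ i : Fin q, exponents n (d i)) → Ω → ℝ,
    (∀ ω i, (f ω i : MvPolynomial (Fin (n + 1)) ℝ) =
      ∑ α : exponents n (d i),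
        MvPolynomial.monomial α.1 (√(α.1.multinomial : ℝ) * c ⟨i, α⟩ ω)) ∧
    (∀ j, Measurable (c j)) ∧
    iIndepFun c P ∧
    (∀ j, ∫ ω, c j ω ∂P = 0) ∧
    (∀ j, IsSubgaussian P (c j)) ∧
    (∀ j, psiTwoNorm P (c j) ≤ K) ∧
    (∀ j, AntiConcentration P (c j) ρ)

end Dobro

end

noncomputable section

/-! ### Chebyshev polynomials as extremal lower bounds near the endpoint 1 -/

namespace Polynomial.Chebyshev

open Real

/-! The supremum over the sphere is controlled by averaging over a cone around a maximum point.

Deterministic part. Let `|f_i|` attain `supNorm f` at `x`. On a great circle through `x`, the part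
of `f_i` that is even in the angle is a polynomial in the cosine `u`, of degree at most `D`, bounded
by `|f_i(x)|` on `[-1, 1]` and equal to `f_i(x)` at 1. After division by `f_i(x)` it dominates the
Chebyshev polynomial `T_D` near 1, and `T_D(u) ≥ 1 - D²(1 - u)`. So for `z` in the double cone `|⟨x,
z⟩| ≥ 1 - 1/(4D²)`, the mean of `f_i` at `z` and at its mirror image in the axis has absolute value
at least `3/4 |f_i(x)|` (`mul_abs_eval_le_abs_add`). As `cosh` is convex and even, the average of
`cosh(s f_i)` over the cone is at least `cosh(3/4 s |f_i(x)|)`.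

Probabilistic part. The moment bounds give each centered coefficient the moment generating function
bound `exp(5/3 s²K²)` (`MomentBound.hasSubgaussianMGF`). The squares of the weighted monomials sum
to `‖y‖^(2 d_i)`, so independence transfers this bound to `f_i(y)` for `‖y‖ ≤ 1`. Fubini over the
unit ball and Markov's inequality give, with `2κ` a lower bound for the fraction of the ball in the
cone, `κ exp(3/4 s t) P(‖f‖ ≥ t) ≤ q exp(5/3 s²K²)` (`IsDobro.measureReal_mul_le`).

Optimising `s` leaves `exp(-27/320 t²/K²)`, which decays faster than `exp(-t²/(17K²))`. The surplus
absorbs the excess of `κ⁻¹` over the claimed prefactor whenever the claimed bound is not already at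
least 1. The moments follow by integrating the tail. -/

theorem eval_T_le_eval_of_forall_abs_le_one {N : ℕ} {P : ℝ[X]}
    (hdeg : P.degree ≤ N) (hbound : ∀ x ∈ Set.Icc (-1) 1, |P.eval x| ≤ 1)
    (hone : P.eval 1 = 1) {u : ℝ} (hu : node N 1 ≤ u) (hu1 : u ≤ 1) :
    (T ℝ N).eval u ≤ P.eval u := by
  set c : ℕ → ℝ := fun i => ∏ j ∈ (Finset.range (N + 1)).erase i,
    (u - node N j) * (node N i - node N j)⁻¹ with hc
  have key : ∀ Q : ℝ[X], Q.degree ≤ N →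
      Q.eval u = ∑ i ∈ Finset.range (N + 1), Q.eval (node N i) * c i := by
    intro Q hQ
    have hlt : Q.degree < (Finset.range (N + 1)).card := by
      rw [Finset.card_range]
      grw [hQ]
      norm_cast
      simp
    conv_lhs => rw [Lagrange.eq_interpolate (strictAntiOn_node N).injOn hlt]
    rw [Lagrange.interpolate_apply, eval_finsetSum]
    refine Finset.sum_congr rfl fun i _ => ?_
    rw [eval_mul, eval_C, Lagrange.basis, eval_prod]
    congr 1
    refine Finset.prod_congr rfl fun j _ => ?_
    simp [Lagrange.basisDivisor, mul_comm]
  -- Both polynomials are interpolated at the extremal nodes `cos(iπ/N)`, where `T` takes the values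
  -- `(-1)^i`; the comparison is then made term by term.
  rw [key P hdeg, key (T ℝ N) (by simp)]
  refine Finset.sum_le_sum fun i hi => ?_
  have hiN : i ≤ N := Finset.mem_range_succ_iff.mp hi
  rw [eval_T_real_node (Finset.mem_Iic.mpr hiN)]
  rcases Nat.eq_zero_or_pos i with rfl | hipos
  · simp [node_eq_one, hone]
  have hnum : ∏ j ∈ (Finset.range (N + 1)).erase i, (u - node N j) ≤ 0 := by
    have h0 : 0 ∈ (Finset.range (N + 1)).erase i := by simp; omega
    rw [← Finset.mul_prod_erase _ _ h0]
    refine mul_nonpos_of_nonpos_of_nonneg (by rw [node_eq_one]; linarith) ?_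
    refine Finset.prod_nonneg fun j hj => ?_
    simp only [Finset.mem_erase, Finset.mem_range] at hj
    have : node N j ≤ node N 1 := by
      rcases Nat.lt_or_ge 1 j with h | h
      · exact (node_lt (by omega) h).le
      · have : j = 1 := by omega
        rw [this]
    linarith
  have hden := zero_lt_prod_node_sub_node hiN
  -- For `u` between nodes 1 and 0, only the factor at node 0 is nonpositive, so each weight with `i
  -- ≥ 1` has sign opposite to `T` at its node. Hence `T` makes these terms as small as the bound by
  -- 1 permits.
  have hsign : (-1) ^ i * c i ≤ 0 := by
    have : (-1) ^ i * c i = (∏ j ∈ (Finset.range (N + 1)).erase i, (u - node N j)) *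
        ((-1) ^ i * ∏ j ∈ (Finset.range (N + 1)).erase i, (node N i - node N j))⁻¹ := by
      rw [hc]
      simp only [Finset.prod_mul_distrib, Finset.prod_inv_distrib, mul_inv, ← inv_pow]
      norm_num
      ring
    rw [this]
    exact mul_nonpos_of_nonpos_of_nonneg hnum (inv_nonneg.mpr hden.le)
  have hb := abs_le.mp (hbound _ (node_mem_Icc (n := N) (i := i)))
  rcases Nat.even_or_odd i with h | h
  · rw [h.neg_one_pow] at hsign ⊢
    nlinarith
  · rw [h.neg_one_pow] at hsign ⊢
    nlinarith

/-- With `u = cos 2y`, `T_N(u) = 1 - 2 sin²(Ny)`, and `|sin(Ny)| ≤ N |sin y|`. -/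
theorem one_sub_sq_mul_le_eval_T (N : ℕ) {u : ℝ} (hu : -1 ≤ u) (hu1 : u ≤ 1) :
    1 - (N : ℝ) ^ 2 * (1 - u) ≤ (T ℝ N).eval u := by
  have hsin : ∀ (k : ℕ) (y : ℝ), |sin (k * y)| ≤ k * |sin y| := by
    intro k y
    induction k with
    | zero => simp
    | succ k ih =>
      push_cast
      rw [add_mul, one_mul, sin_add]
      calc |sin (k * y) * cos y + cos (k * y) * sin y|
          ≤ |sin (k * y) * cos y| + |cos (k * y) * sin y| := abs_add_le _ _
        _ = |sin (k * y)| * |cos y| + |cos (k * y)| * |sin y| := by rw [abs_mul, abs_mul]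
        _ ≤ |sin (k * y)| * 1 + 1 * |sin y| := by
          gcongr
          · exact abs_cos_le_one _
          · exact abs_cos_le_one _
        _ ≤ (k + 1) * |sin y| := by linarith
  have h1 : u = cos (2 * (arccos u / 2)) := by
    rw [mul_div_cancel₀ _ two_ne_zero, cos_arccos hu hu1]
  set y := arccos u / 2
  have h2 := hsin N y
  have h3 : sin (N * y) ^ 2 ≤ (N : ℝ) ^ 2 * sin y ^ 2 := by
    rw [← sq_abs (sin (N * y)), ← sq_abs (sin y), ← mul_pow]
    gcongr
  rw [h1, T_real_cos, show (((N : ℕ) : ℤ) : ℝ) * (2 * y) = 2 * (N * y) by push_cast; ring,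
    cos_two_mul', cos_two_mul', cos_sq', cos_sq']
  nlinarith

theorem one_sub_sq_mul_le_eval_of_forall_abs_le_one {N : ℕ} (hN : 1 ≤ N) {P : ℝ[X]}
    (hdeg : P.degree ≤ N) (hbound : ∀ x ∈ Set.Icc (-1) 1, |P.eval x| ≤ 1)
    (hone : P.eval 1 = 1) {u : ℝ} (hu : 1 - 2 / (N : ℝ) ^ 2 ≤ u) (hu1 : u ≤ 1) :
    1 - (N : ℝ) ^ 2 * (1 - u) ≤ P.eval u := by
  have hN' : (1 : ℝ) ≤ N := by exact_mod_cast hN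
  have hnode : node N 1 ≤ u := by
    refine le_trans ?_ hu
    rw [node]
    have hle : |((1 : ℕ) : ℝ) * π / N| ≤ π := by
      rw [abs_of_nonneg (by positivity)]
      simpa using div_le_self pi_pos.le hN'
    -- The bound `cos θ ≤ 1 - 2θ²/π²` at `θ = π/N` is exactly `1 - 2/N²`.
    refine (cos_le_one_sub_mul_cos_sq hle).trans (le_of_eq ?_)
    have := pi_pos.ne'
    field_simp
    norm_num
  refine (one_sub_sq_mul_le_eval_T N ?_ hu1).trans
    (eval_T_le_eval_of_forall_abs_le_one hdeg hbound hone hnode hu1)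
  exact (node_mem_Icc (n := N) (i := 1)).1.trans hnode

end Polynomial.Chebyshev

/-! ### Restriction of polynomials to great circles -/

namespace Dobro

open Polynomial in
/-- On the unit circle, `h a b` agrees with `p a + b q a` for polynomials `p` of degree at most `N`
and `q` of degree less than `N`. -/
def IsCirclePoly (N : ℕ) (h : ℝ → ℝ → ℝ) : Prop :=
  ∃ p q : ℝ[X], p.natDegree ≤ N ∧ (q = 0 ∨ q.natDegree + 1 ≤ N) ∧
    ∀ a b : ℝ, a ^ 2 + b ^ 2 = 1 → h a b = p.eval a + b * q.eval a

namespace IsCirclePoly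

open Polynomial

theorem mono {N N' : ℕ} {h : ℝ → ℝ → ℝ} (hh : IsCirclePoly N h) (hN : N ≤ N') :
    IsCirclePoly N' h := by
  obtain ⟨p, q, hp, hq, he⟩ := hh
  exact ⟨p, q, hp.trans hN, hq.imp_right (·.trans hN), he⟩

theorem const (c : ℝ) : IsCirclePoly 0 (fun _ _ => c) :=
  ⟨C c, 0, by simp, Or.inl rfl, by simp⟩

theorem linear (α β : ℝ) : IsCirclePoly 1 (fun a b => a * α + b * β) := by
  refine ⟨C α * X, C β, (natDegree_C_mul_le _ _).trans natDegree_X_le, Or.inr (by simp), fun a b _ => ?_⟩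
  simp
  ring

theorem add {N : ℕ} {h k : ℝ → ℝ → ℝ} (hh : IsCirclePoly N h) (hk : IsCirclePoly N k) :
    IsCirclePoly N (fun a b => h a b + k a b) := by
  obtain ⟨p, q, hp, hq, he⟩ := hh
  obtain ⟨p', q', hp', hq', he'⟩ := hk
  refine ⟨p + p', q + q', natDegree_add_le_of_degree_le hp hp', ?_, fun a b hab => ?_⟩
  · rcases hq with rfl | hq
    · simpa using hq'
    rcases hq' with rfl | hq'
    · simpa using Or.inr hq
    have : (q + q').natDegree ≤ N - 1 :=
      natDegree_add_le_of_degree_le (by omega) (by omega)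
    right
    omega
  · simp only [he a b hab, he' a b hab, eval_add]
    ring

/-- The product of the two `b`-parts is reduced by `b² = 1 - a²`; the strict degree bound on `q`
pays for the two extra degrees. -/
theorem mul {N N' : ℕ} {h k : ℝ → ℝ → ℝ} (hh : IsCirclePoly N h) (hk : IsCirclePoly N' k) :
    IsCirclePoly (N + N') (fun a b => h a b * k a b) := by
  obtain ⟨p, q, hp, hq, he⟩ := hh
  obtain ⟨p', q', hp', hq', he'⟩ := hk
  have hX : (1 - X ^ 2 : ℝ[X]).natDegree ≤ 2 :=
    (natDegree_sub_le _ _).trans (by simp)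
  refine ⟨p * p' + (1 - X ^ 2) * (q * q'), p * q' + p' * q, ?_, ?_, fun a b hab => ?_⟩
  · refine natDegree_add_le_of_degree_le (natDegree_mul_le.trans (by omega)) ?_
    rcases hq with rfl | hq
    · simp
    rcases hq' with rfl | hq'
    · simp
    refine natDegree_mul_le.trans ?_
    have := natDegree_mul_le (p := q) (q := q')
    omega
  · rcases hq with rfl | hq
    · rcases hq' with rfl | hq'
      · simp
      · right
        have := natDegree_mul_le (p := p) (q := q')
        simp only [mul_zero, add_zero]
        omega
    · right
      have h1 := natDegree_mul_le (p := p') (q := q)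
      rcases hq' with rfl | hq'
      · simp only [mul_zero, zero_add]
        omega
      · have h2 := natDegree_mul_le (p := p) (q := q')
        have : (p * q' + p' * q).natDegree ≤ N + N' - 1 :=
          natDegree_add_le_of_degree_le (by omega) (by omega)
        omega
  · simp only [he a b hab, he' a b hab, eval_add, eval_mul, eval_sub, eval_one, eval_pow, eval_X]
    linear_combination (eval a q * eval a q') * hab

theorem pow {N : ℕ} {h : ℝ → ℝ → ℝ} (hh : IsCirclePoly N h) (m : ℕ) :
    IsCirclePoly (m * N) (fun a b => h a b ^ m) := by
  induction m with
  | zero => simpa using const 1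
  | succ m ih => simpa only [pow_succ, Nat.succ_mul] using ih.mul hh

theorem prod {ι : Type*} (s : Finset ι) {N : ι → ℕ} {h : ι → ℝ → ℝ → ℝ}
    (hh : ∀ i, IsCirclePoly (N i) (h i)) :
    IsCirclePoly (∑ i ∈ s, N i) (fun a b => ∏ i ∈ s, h i a b) := by
  classical
  induction s using Finset.induction_on with
  | empty => simpa using const 1
  | insert i s hi ih => simpa only [Finset.sum_insert hi, Finset.prod_insert hi] using (hh i).mul ih

theorem sum {ι : Type*} (s : Finset ι) {N : ℕ} {h : ι → ℝ → ℝ → ℝ}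
    (hh : ∀ i ∈ s, IsCirclePoly N (h i)) :
    IsCirclePoly N (fun a b => ∑ i ∈ s, h i a b) := by
  classical
  induction s using Finset.induction_on with
  | empty => simpa using (const 0).mono (Nat.zero_le N)
  | insert i s hi ih =>
    simp only [Finset.sum_insert hi]
    exact (hh i (by simp)).add (ih fun j hj => hh j (by simp [hj]))

theorem eval {σ : Type*} {f : MvPolynomial σ ℝ} {N : ℕ} (hf : f.totalDegree ≤ N) (x w : σ → ℝ) :
    IsCirclePoly N (fun a b => MvPolynomial.eval (fun j => a * x j + b * w j) f) := by
  simp only [MvPolynomial.eval_eq]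
  refine sum _ fun m hm => ?_
  have h1 := (const (f.coeff m)).mul
    (prod m.support (fun j => (linear (x j) (w j)).pow (m j)))
  refine h1.mono ?_
  refine le_trans ?_ ((MvPolynomial.le_totalDegree hm).trans hf)
  simp [Finsupp.sum]

end IsCirclePoly

theorem eval_neg_of_isHomogeneous {σ : Type*} {f : MvPolynomial σ ℝ} {e : ℕ}
    (hf : f.IsHomogeneous e) (x : σ → ℝ) :
    MvPolynomial.eval (fun j => -x j) f = (-1) ^ e * MvPolynomial.eval x f := by
  rw [MvPolynomial.eval_eq, MvPolynomial.eval_eq, Finset.mul_sum]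
  refine Finset.sum_congr rfl fun m hm => ?_
  have hdeg : ∑ i ∈ m.support, m i = e := by
    rw [← hf (MvPolynomial.mem_support_iff.mp hm), Finsupp.weight_apply, Finsupp.sum]
    simp
  simp only [neg_pow (x _)]
  rw [Finset.prod_mul_distrib, Finset.prod_pow_eq_pow_sum, hdeg]
  ring

variable {n : ℕ}

/-- The reflection fixing the line spanned by the unit vector `x`. -/
abbrev axisReflection (x : EuclideanSpace ℝ (Fin (n + 1))) :
    EuclideanSpace ℝ (Fin (n + 1)) ≃ₗᵢ[ℝ] EuclideanSpace ℝ (Fin (n + 1)) :=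
  (Submodule.span ℝ {x}).reflection

theorem axisReflection_apply {x : EuclideanSpace ℝ (Fin (n + 1))} (hx : ‖x‖ = 1)
    (z : EuclideanSpace ℝ (Fin (n + 1))) :
    axisReflection x z = (2 * inner ℝ x z) • x - z := by
  rw [axisReflection, Submodule.reflection_singleton_apply, hx]
  simp [two_smul, two_mul, add_smul]

theorem inner_axisReflection {x : EuclideanSpace ℝ (Fin (n + 1))} (hx : ‖x‖ = 1)
    (z : EuclideanSpace ℝ (Fin (n + 1))) :
    inner ℝ x (axisReflection x z) = inner ℝ x z := by
  rw [axisReflection_apply hx, inner_sub_right, inner_smul_right, real_inner_self_eq_norm_sq, hx]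
  ring

/-- Write `z = u x + r v` with `v` a unit vector orthogonal to `x`. The reflection flips the sign of
`r`, so the mean cancels the odd part and equals `p(u)`, to which the Chebyshev comparison applies.
-/
theorem mul_abs_eval_le_abs_add_of_le_inner {f : MvPolynomial (Fin (n + 1)) ℝ} {N : ℕ}
    (hN : 1 ≤ N) (hf : f.totalDegree ≤ N) {x z : EuclideanSpace ℝ (Fin (n + 1))}
    (hx : ‖x‖ = 1) (hz : ‖z‖ = 1)
    (hmax : ∀ y : EuclideanSpace ℝ (Fin (n + 1)), ‖y‖ = 1 →
      |MvPolynomial.eval (fun j => y j) f| ≤ |MvPolynomial.eval (fun j => x j) f|)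
    (hxz : 1 - 2 / (N : ℝ) ^ 2 ≤ inner ℝ x z) :
    (1 - (N : ℝ) ^ 2 * (1 - inner ℝ x z)) * |MvPolynomial.eval (fun j => x j) f| ≤
      |(MvPolynomial.eval (fun j => z j) f +
        MvPolynomial.eval (fun j => axisReflection x z j) f) / 2| := by
  set u : ℝ := inner ℝ x z with hu
  have hu1 : u ≤ 1 := by simpa [hx, hz] using real_inner_le_norm x z
  set w := z - u • x with hw
  have hxw : inner ℝ x w = 0 := by
    rw [hw, inner_sub_right, inner_smul_right, real_inner_self_eq_norm_sq, hx]
    simp [← hu]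
  have hzw : z = u • x + w := by rw [hw]; abel
  have hRw : axisReflection x z = u • x + -w := by
    rw [axisReflection_apply hx, hw, ← hu, two_mul, add_smul]; abel
  have hnorm : ∀ (a b : ℝ) (v : EuclideanSpace ℝ (Fin (n + 1))), inner ℝ x v = 0 →
      ‖a • x + b • v‖ ^ 2 = a ^ 2 + b ^ 2 * ‖v‖ ^ 2 := by
    intro a b v hv
    rw [norm_add_sq_real, inner_smul_left, inner_smul_right, hv, norm_smul, norm_smul, hx]
    simp [mul_pow]
  have hw2 : u ^ 2 + ‖w‖ ^ 2 = 1 := by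
    have := hnorm u 1 w hxw
    rw [one_smul, ← hzw, hz] at this
    linarith
  -- Here `z = x` or `z = -x`; in the second case the factor `1 - 2N²` is negative.
  by_cases hw0 : w = 0
  · have hcase : u = 1 ∨ u = -1 := by
      rw [hw0] at hw2
      simpa using hw2
    have hR : axisReflection x z = z := by rw [hRw, hzw, hw0]; simp
    rw [hR, add_self_div_two]
    rcases hcase with h | h
    · rw [hzw, hw0, h]
      simp
    · have : (1 : ℝ) ≤ (N : ℝ) := by exact_mod_cast hN
      refine le_trans ?_ (abs_nonneg _)
      refine mul_nonpos_of_nonpos_of_nonneg ?_ (abs_nonneg _)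
      rw [h]
      nlinarith
  set r := ‖w‖ with hr
  have hr0 : 0 < r := norm_pos_iff.mpr hw0
  set v := r⁻¹ • w with hv
  have hv1 : ‖v‖ = 1 := by
    rw [hv, norm_smul, norm_inv, norm_norm, ← hr, inv_mul_cancel₀ hr0.ne']
  have hxv : inner ℝ x v = 0 := by rw [hv, inner_smul_right, hxw, mul_zero]
  have hwv : w = r • v := by rw [hv, smul_smul, mul_inv_cancel₀ hr0.ne', one_smul]
  obtain ⟨p, q, hp, -, he⟩ := IsCirclePoly.eval hf (fun j => x j) (fun j => v j)
  have he' : ∀ a b : ℝ, a ^ 2 + b ^ 2 = 1 →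
      MvPolynomial.eval (fun j => (a • x + b • v) j) f = p.eval a + b * q.eval a := by
    intro a b hab
    rw [← he a b hab]
    rfl
  have hunit : ∀ a b : ℝ, a ^ 2 + b ^ 2 = 1 → ‖a • x + b • v‖ = 1 := by
    intro a b hab
    have := hnorm a b v hxv
    rw [hv1, one_pow, mul_one, hab] at this
    nlinarith [norm_nonneg (a • x + b • v)]
  have hp1 : p.eval 1 = MvPolynomial.eval (fun j => x j) f := by
    have := he' 1 0 (by norm_num)
    simpa using this.symm
  have hpu : (MvPolynomial.eval (fun j => z j) f +
      MvPolynomial.eval (fun j => axisReflection x z j) f) / 2 = p.eval u := by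
    rw [hRw, hwv]
    nth_rewrite 1 [hzw]
    rw [hwv, he' u r hw2, ← neg_smul, he' u (-r) (by simpa using hw2)]
    ring
  rw [hpu]
  set m := MvPolynomial.eval (fun j => x j) f with hm
  by_cases hm0 : m = 0
  · simp [hm0]
  -- `p(a)` is the mean of the values of `f` at the two unit vectors `a x ± √(1 - a²) v`.
  have hbound : ∀ a ∈ Set.Icc (-1 : ℝ) 1, |(Polynomial.C m⁻¹ * p).eval a| ≤ 1 := by
    intro a ha
    have hb : a ^ 2 + √(1 - a ^ 2) ^ 2 = 1 := by
      rw [Real.sq_sqrt (by nlinarith [ha.1, ha.2])]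
      ring
    have hb' : a ^ 2 + (-√(1 - a ^ 2)) ^ 2 = 1 := by rw [neg_sq, hb]
    have h1 := abs_le.mp (hmax _ (hunit _ _ hb))
    have h2 := abs_le.mp (hmax _ (hunit _ _ hb'))
    rw [he' _ _ hb] at h1
    rw [he' _ _ hb'] at h2
    rw [Polynomial.eval_mul, Polynomial.eval_C, abs_mul, abs_inv,
      inv_mul_le_iff₀ (abs_pos.mpr hm0), mul_one, abs_le]
    constructor <;> linarith [h1.1, h1.2, h2.1, h2.2]
  have hdeg : (Polynomial.C m⁻¹ * p).degree ≤ N :=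
    Polynomial.natDegree_le_iff_degree_le.mp ((Polynomial.natDegree_C_mul_le _ _).trans hp)
  have key := Polynomial.Chebyshev.one_sub_sq_mul_le_eval_of_forall_abs_le_one hN hdeg hbound
    (by rw [Polynomial.eval_mul, Polynomial.eval_C, hp1, inv_mul_cancel₀ hm0]) hxz hu1
  rw [Polynomial.eval_mul, Polynomial.eval_C] at key
  calc _ ≤ m⁻¹ * p.eval u * |m| := by gcongr
    _ ≤ |m⁻¹ * p.eval u * m| := by
      rw [abs_mul]
      gcongr
      exact le_abs_self _
    _ = |p.eval u| := by rw [mul_right_comm, inv_mul_cancel₀ hm0, one_mul]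

/-- Averaging a homogeneous polynomial over a point near the axis of its maximum `x` and the mirror
image of that point loses only a factor quadratic in the distance. -/
theorem mul_abs_eval_le_abs_add {f : MvPolynomial (Fin (n + 1)) ℝ} {N e : ℕ}
    (hN : 1 ≤ N) (hf : f.IsHomogeneous e) (he : e ≤ N) {x z : EuclideanSpace ℝ (Fin (n + 1))}
    (hx : ‖x‖ = 1) (hz : ‖z‖ = 1)
    (hmax : ∀ y : EuclideanSpace ℝ (Fin (n + 1)), ‖y‖ = 1 →
      |MvPolynomial.eval (fun j => y j) f| ≤ |MvPolynomial.eval (fun j => x j) f|)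
    (hxz : 1 - 2 / (N : ℝ) ^ 2 ≤ |inner ℝ x z|) :
    (1 - (N : ℝ) ^ 2 * (1 - |inner ℝ x z|)) * |MvPolynomial.eval (fun j => x j) f| ≤
      |(MvPolynomial.eval (fun j => z j) f +
        MvPolynomial.eval (fun j => axisReflection x z j) f) / 2| := by
  have hdeg : f.totalDegree ≤ N := hf.totalDegree_le.trans he
  rcases le_total 0 (inner ℝ x z) with h | h
  · rw [abs_of_nonneg h] at hxz ⊢
    exact mul_abs_eval_le_abs_add_of_le_inner hN hdeg hx hz hmax hxz
  · rw [abs_of_nonpos h, ← inner_neg_right] at hxz ⊢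
    refine (mul_abs_eval_le_abs_add_of_le_inner hN hdeg hx (by rwa [norm_neg]) hmax hxz).trans ?_
    have h1 := eval_neg_of_isHomogeneous hf (fun j => z j)
    have h2 := eval_neg_of_isHomogeneous hf (fun j => axisReflection x z j)
    have h3 : (fun j => (-z) j) = fun j => -z j := rfl
    have h4 : (fun j => axisReflection x (-z) j) = fun j => -axisReflection x z j := by
      rw [map_neg]; rfl
    rw [h3, h4, h1, h2, ← mul_add, mul_div_assoc, abs_mul, abs_pow, abs_neg, abs_one, one_pow,
      one_mul]

/-! ### Exponential moments from the moment bounds -/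

open scoped Nat

theorem two_mul_pow_mul_factorial_le {k : ℕ} (hk : 3 ≤ k) :
    (2 * k : ℝ) ^ k * k ! * (9 / 4) ≤ (5 / 3) ^ k * (2 * k)! := by
  induction k, hk using Nat.le_induction with
  | base => norm_num [Nat.factorial]
  | succ k hk ih =>
    have hk' : (3 : ℝ) ≤ k := by exact_mod_cast hk
    have hk0 : (0 : ℝ) < k := by linarith
    have h1 : (2 * (k + 1) : ℝ) ^ k ≤ 2.7182818286 * (2 * k) ^ k := by
      have h2 : (2 * (k + 1) : ℝ) ^ k = (1 / k + 1) ^ k * (2 * k) ^ k := by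
        rw [← mul_pow]
        congr 1
        field_simp
        ring
      rw [h2]
      gcongr
      calc (1 / k + 1 : ℝ) ^ k ≤ Real.exp (1 / k) ^ k := by
            gcongr
            exact Real.add_one_le_exp _
        _ = Real.exp 1 := by
            rw [← Real.exp_nat_mul, mul_one_div_cancel hk0.ne']
        _ ≤ _ := Real.exp_one_lt_d9.le
    have hf : ((2 * (k + 1))! : ℝ) = (2 * k + 2) * ((2 * k + 1) * (2 * k)!) := by
      rw [show 2 * (k + 1) = 2 * k + 1 + 1 by ring, Nat.factorial_succ, Nat.factorial_succ]
      push_cast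
      ring
    have hg : (((k + 1)! : ℕ) : ℝ) = (k + 1) * k ! := by
      rw [Nat.factorial_succ]; push_cast; ring
    push_cast
    rw [hf, hg, pow_succ, pow_succ]
    calc (2 * (k + 1) : ℝ) ^ k * (2 * (k + 1)) * ((k + 1) * k !) * (9 / 4)
        ≤ 2.7182818286 * (2 * k) ^ k * (2 * (k + 1)) * ((k + 1) * k !) * (9 / 4) := by gcongr
      _ = (2.7182818286 * (k + 1)) * (2 * (k + 1)) * ((2 * k : ℝ) ^ k * k ! * (9 / 4)) := by ring
      _ ≤ (5 / 3 * (2 * k + 1)) * (2 * (k + 1)) * ((5 / 3) ^ k * (2 * k)!) := by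
          exact mul_le_mul (mul_le_mul_of_nonneg_right (by linarith) (by positivity)) ih
            (by positivity) (by positivity)
      _ = _ := by ring

/-- The left side is the total coefficient of `a^k`, `a = s²K²`, after odd powers are split between
their even neighbours. The constant `5/3` is nearly sharp at `k = 2`, which is checked separately;
from `k = 3` on the bracket may be replaced by `9/4`. -/
theorem expWeight_le {k : ℕ} (hk : 2 ≤ k) :
    (2 * k : ℝ) ^ k / (2 * k)! * (1 + (k + 2) / (2 * (2 * k + 1)) + k / (k + 1)) ≤
      (5 / 3) ^ k / k ! := by
  rcases hk.eq_or_lt with rfl | hk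
  · norm_num [Nat.factorial]
  have hk' : (3 : ℝ) ≤ k := by exact_mod_cast hk
  have h1 : (1 + (k + 2) / (2 * (2 * k + 1)) + k / (k + 1) : ℝ) ≤ 9 / 4 := by
    have : (9 / 4 : ℝ) - (1 + (k + 2) / (2 * (2 * k + 1)) + k / (k + 1)) =
        (5 / 2 * k + 1 / 2) / (2 * (2 * k + 1) * (k + 1)) := by
      field_simp
      ring
    have h2 : (0 : ℝ) ≤ (5 / 2 * k + 1 / 2) / (2 * (2 * k + 1) * (k + 1)) := by positivity
    linarith
  have hf : (0 : ℝ) < (2 * k)! := by positivity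
  have hg : (0 : ℝ) < k ! := by positivity
  calc (2 * k : ℝ) ^ k / (2 * k)! * (1 + (k + 2) / (2 * (2 * k + 1)) + k / (k + 1))
      ≤ (2 * k : ℝ) ^ k / (2 * k)! * (9 / 4) := by gcongr
    _ ≤ (5 / 3) ^ k / k ! := by
      rw [le_div_iff₀ hg, div_mul_eq_mul_div, div_mul_eq_mul_div, div_le_iff₀ hf]
      linarith [two_mul_pow_mul_factorial_le hk]

theorem hasSum_exp_sub_one_sub (x : ℝ) :
    HasSum (fun m : ℕ => x ^ (2 * m + 2) / (2 * m + 2)! + x ^ (2 * m + 3) / (2 * m + 3)!)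
      (Real.exp x - 1 - x) := by
  have h := NormedSpace.expSeries_div_hasSum_exp x
  rw [← Real.exp_eq_exp_ℝ] at h
  have h2 := (hasSum_nat_add_iff' 2).mpr h
  have h3 : Real.exp x - ∑ i ∈ Finset.range 2, x ^ i / i ! = Real.exp x - 1 - x := by
    simp [Finset.sum_range_succ]; ring
  rw [h3] at h2
  have he : Summable fun m : ℕ => x ^ (2 * m + 2) / (2 * m + 2)! :=
    h2.summable.comp_injective (i := fun m : ℕ => 2 * m) fun a b hab => by simpa using hab
  have ho : Summable fun m : ℕ => x ^ (2 * m + 3) / (2 * m + 3)! := by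
    have := h2.summable.comp_injective (i := fun m : ℕ => 2 * m + 1) fun a b hab => by
      simpa using hab
    exact this
  have h4 := HasSum.even_add_odd (f := fun k : ℕ => x ^ (k + 2) / (k + 2)!)
    he.hasSum ho.hasSum
  rw [h2.unique h4]
  exact he.hasSum.add ho.hasSum

theorem ofReal_exp_sub_one_sub_le (x : ℝ) :
    ENNReal.ofReal (Real.exp x - 1 - x) ≤
      ∑' m : ℕ, (ENNReal.ofReal (1 / (2 * m + 2)! + (m + 3) / (2 * (2 * m + 3)!)) *
          ENNReal.ofReal (x ^ (2 * m + 2)) +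
        ENNReal.ofReal (1 / (2 * (m + 3) * (2 * m + 3)!)) * ENNReal.ofReal (x ^ (2 * m + 4))) := by
  refine le_of_tendsto' ((ENNReal.continuous_ofReal.tendsto _).comp
    (hasSum_exp_sub_one_sub x)) fun s => ?_
  refine le_trans ?_ (ENNReal.sum_le_tsum s)
  refine le_trans ?_ (le_of_eq ?_ : ENNReal.ofReal (∑ m ∈ s,
    ((1 / (2 * m + 2)! + (m + 3) / (2 * (2 * m + 3)!)) * x ^ (2 * m + 2) +
      1 / (2 * (m + 3) * (2 * m + 3)!) * x ^ (2 * m + 4))) ≤ _)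
  · refine ENNReal.ofReal_le_ofReal (Finset.sum_le_sum fun m _ => ?_)
    have hf : (0 : ℝ) < (2 * m + 3)! := by positivity
    have hm : (0 : ℝ) < m + 3 := by positivity
    -- A weighted AM-GM inequality removes odd powers, whose signs are uncontrolled.
    have key : x ^ (2 * m + 3) ≤ (m + 3) / 2 * x ^ (2 * m + 2) +
        1 / (2 * (m + 3)) * x ^ (2 * m + 4) := by
      have h1 : (m + 3) / 2 * x ^ (2 * m + 2) + 1 / (2 * (m + 3)) * x ^ (2 * m + 4) -
          x ^ (2 * m + 3) = (x ^ (m + 1)) ^ 2 * (m + 3 - x) ^ 2 / (2 * (m + 3)) := by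
        field_simp
        ring
      have h2 : 0 ≤ (x ^ (m + 1)) ^ 2 * (m + 3 - x) ^ 2 / (2 * (m + 3)) := by positivity
      linarith
    have h3 : x ^ (2 * m + 3) / (2 * m + 3)! ≤ ((m + 3) / 2 * x ^ (2 * m + 2) +
        1 / (2 * (m + 3)) * x ^ (2 * m + 4)) / (2 * m + 3)! := by gcongr
    refine (add_le_add_right h3 _).trans (le_of_eq ?_)
    field_simp
    ring
  · have hx2 : 0 ≤ x ^ 2 := sq_nonneg x
    have hev : ∀ m : ℕ, 0 ≤ x ^ (2 * m + 2) := fun m => by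
      rw [show 2 * m + 2 = 2 * (m + 1) by ring, pow_mul]; positivity
    have hev' : ∀ m : ℕ, 0 ≤ x ^ (2 * m + 4) := fun m => by
      rw [show 2 * m + 4 = 2 * (m + 2) by ring, pow_mul]; positivity
    rw [ENNReal.ofReal_sum_of_nonneg]
    · refine Finset.sum_congr rfl fun m _ => ?_
      rw [ENNReal.ofReal_add (mul_nonneg (by positivity) (hev m))
        (mul_nonneg (by positivity) (hev' m)), ENNReal.ofReal_mul (by positivity),
        ENNReal.ofReal_mul (by positivity)]
    · intro m _
      exact add_nonneg (mul_nonneg (by positivity) (hev m)) (mul_nonneg (by positivity) (hev' m))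

theorem tsum_moments_le {a : ℝ} (ha : 0 ≤ a) :
    ∑' m : ℕ, (ENNReal.ofReal (1 / (2 * m + 2)! + (m + 3) / (2 * (2 * m + 3)!)) *
          ENNReal.ofReal ((2 * (m + 1)) ^ (m + 1) * a ^ (m + 1)) +
        ENNReal.ofReal (1 / (2 * (m + 3) * (2 * m + 3)!)) *
          ENNReal.ofReal ((2 * (m + 2)) ^ (m + 2) * a ^ (m + 2))) ≤
      ENNReal.ofReal (Real.exp (5 / 3 * a) - 1) := by
  rw [ENNReal.tsum_add, tsum_eq_zero_add' (f := fun m : ℕ => ENNReal.ofReal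
    (1 / (2 * m + 2)! + (m + 3) / (2 * (2 * m + 3)!)) *
      ENNReal.ofReal ((2 * (m + 1)) ^ (m + 1) * a ^ (m + 1))) ENNReal.summable, add_assoc,
    ← ENNReal.tsum_add]
  have hsum : HasSum (fun m : ℕ => (5 / 3 * a) ^ (m + 1) / (m + 1)!)
      (Real.exp (5 / 3 * a) - 1) := by
    have h := NormedSpace.expSeries_div_hasSum_exp (5 / 3 * a)
    rw [← Real.exp_eq_exp_ℝ] at h
    simpa using (hasSum_nat_add_iff' 1).mpr h
  rw [← hsum.tsum_eq, ENNReal.ofReal_tsum_of_nonneg (fun m => by positivity) hsum.summable,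
    tsum_eq_zero_add' (f := fun m : ℕ => ENNReal.ofReal ((5 / 3 * a) ^ (m + 1) / (m + 1)!))
      ENNReal.summable]
  refine add_le_add ?_ (ENNReal.tsum_le_tsum fun m => ?_)
  -- The quadratic term has no contribution from below, the linear term being subtracted: its
  -- coefficient is `3/2 ≤ 5/3`.
  · rw [← ENNReal.ofReal_mul (by positivity)]
    refine ENNReal.ofReal_le_ofReal ?_
    norm_num [Nat.factorial]
    linarith
  · rw [← ENNReal.ofReal_mul (by positivity), ← ENNReal.ofReal_mul (by positivity),
      ← ENNReal.ofReal_add (by positivity) (by positivity)]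
    refine ENNReal.ofReal_le_ofReal ?_
    have h := mul_le_mul_of_nonneg_right (expWeight_le (k := m + 2) (by omega))
      (pow_nonneg ha (m + 2))
    refine le_trans (le_of_eq ?_) (h.trans (le_of_eq ?_))
    · have h5 : ((2 * (m + 1) + 3)! : ℝ) = (2 * m + 5) * (2 * m + 4)! := by
        rw [show 2 * (m + 1) + 3 = 2 * m + 4 + 1 by ring, Nat.factorial_succ]
        push_cast; ring
      have h4 : ((2 * m + 4)! : ℝ) = (2 * m + 4) * (2 * m + 3)! := by
        rw [show 2 * m + 4 = 2 * m + 3 + 1 by ring, Nat.factorial_succ]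
        push_cast; ring
      have h3 : (0 : ℝ) < (2 * m + 3)! := by positivity
      rw [h5, show 2 * (m + 1) + 2 = 2 * m + 4 by ring, show 2 * (m + 2) = 2 * m + 4 by ring,
        h4, show m + 1 + 1 = m + 2 by ring]
      push_cast
      rw [show (2 * ((m : ℝ) + 1 + 1)) = 2 * (m + 2) by ring]
      field_simp
      ring
    · rw [show m + 1 + 1 = m + 2 by ring, mul_pow]
      ring

section Moments

variable {Ω : Type*} [MeasurableSpace Ω] {P : Measure Ω} {r : Ω → ℝ} {K : ℝ}

theorem MomentBound.mono {K' : ℝ} (h : MomentBound P r K) (hK : K ≤ K') : MomentBound P r K' :=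
  fun p hp => (h p hp).trans (ENNReal.ofReal_le_ofReal (by gcongr))

/-- The moment bound holds for every constant above the infimum, hence at `K` by letting the
constant decrease to `K`. -/
theorem IsSubgaussian.momentBound (h : IsSubgaussian P r) (hK : psiTwoNorm P r ≤ K) :
    MomentBound P r K := by
  intro p hp
  have hlim : Filter.Tendsto (fun K' : ℝ => ENNReal.ofReal (K' * √p)) (nhdsWithin K (Set.Ioi K))
      (nhds (ENNReal.ofReal (K * √p))) :=
    ((ENNReal.continuous_ofReal.comp (continuous_id.mul continuous_const)).tendsto K).mono_left
      nhdsWithin_le_nhds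
  refine ge_of_tendsto hlim ?_
  filter_upwards [self_mem_nhdsWithin] with K' hK'
  obtain ⟨K₀, hK₀, hlt⟩ := exists_lt_of_csInf_lt h (lt_of_le_of_lt hK hK')
  exact hK₀.2.mono hlt.le p hp

theorem MomentBound.lintegral_pow_le (h : MomentBound P r K) (hK : 0 ≤ K) {k : ℕ} (hk : 1 ≤ k) :
    ∫⁻ ω, ENNReal.ofReal (r ω ^ (2 * k)) ∂P ≤
      ENNReal.ofReal ((2 * k) ^ k * (K ^ 2) ^ k) := by
  have hk' : (1 : ℝ) ≤ k := by exact_mod_cast hk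
  have hp : (1 : ℝ) ≤ 2 * k := by linarith
  have h1 := h (2 * k) hp
  rw [eLpNorm_eq_lintegral_rpow_enorm_toReal (by simpa using by linarith) ENNReal.ofReal_ne_top,
    ENNReal.toReal_ofReal (by linarith), one_div, ENNReal.rpow_inv_le_iff (by linarith)] at h1
  calc ∫⁻ ω, ENNReal.ofReal (r ω ^ (2 * k)) ∂P = ∫⁻ ω, ‖r ω‖ₑ ^ (2 * k : ℝ) ∂P := by
        refine lintegral_congr fun ω => ?_
        rw [show (2 * k : ℝ) = ((2 * k : ℕ) : ℝ) by push_cast; ring, ENNReal.rpow_natCast,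
          ← ofReal_norm, ← ENNReal.ofReal_pow (norm_nonneg _), Real.norm_eq_abs,
          (even_two_mul k).pow_abs]
    _ ≤ _ := h1
    _ = _ := by
        rw [show (2 * k : ℝ) = ((2 * k : ℕ) : ℝ) by push_cast; ring, ENNReal.rpow_natCast,
          ← ENNReal.ofReal_pow (by positivity), mul_pow, pow_mul, pow_mul,
          Real.sq_sqrt (by positivity), mul_comm]

theorem MomentBound.lintegral_exp_sub_one_sub_le (h : MomentBound P r K) (hK : 0 ≤ K)
    (hr : Measurable r) (s : ℝ) :
    ∫⁻ ω, ENNReal.ofReal (Real.exp (s * r ω) - 1 - s * r ω) ∂P ≤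
      ENNReal.ofReal (Real.exp (5 / 3 * (s ^ 2 * K ^ 2)) - 1) := by
  have hmom : ∀ k : ℕ, 1 ≤ k → ∫⁻ ω, ENNReal.ofReal ((s * r ω) ^ (2 * k)) ∂P ≤
      ENNReal.ofReal ((2 * k) ^ k * (s ^ 2 * K ^ 2) ^ k) := by
    intro k hk
    have hs : 0 ≤ s ^ (2 * k) := (even_two_mul k).pow_nonneg s
    simp_rw [mul_pow s, ENNReal.ofReal_mul hs]
    rw [lintegral_const_mul _ (by fun_prop)]
    refine (mul_le_mul_right (h.lintegral_pow_le hK hk) _).trans (le_of_eq ?_)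
    rw [← ENNReal.ofReal_mul hs, pow_mul]
    congr 1
    ring
  refine le_trans ?_ (tsum_moments_le (a := s ^ 2 * K ^ 2) (by positivity))
  refine (lintegral_mono fun ω => ofReal_exp_sub_one_sub_le (s * r ω)).trans ?_
  rw [lintegral_tsum fun m => by fun_prop]
  refine ENNReal.tsum_le_tsum fun m => ?_
  rw [lintegral_add_left (by fun_prop), lintegral_const_mul _ (by fun_prop),
    lintegral_const_mul _ (by fun_prop)]
  have h1 := hmom (m + 1) (by omega)
  have h2 := hmom (m + 2) (by omega)
  push_cast at h1 h2
  gcongr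
  · exact h1
  · exact h2

theorem MomentBound.integrable [IsFiniteMeasure P] (h : MomentBound P r K) (hr : Measurable r) :
    Integrable r P := by
  have := h 1 le_rfl
  rw [ENNReal.ofReal_one] at this
  exact memLp_one_iff_integrable.mp ⟨hr.aestronglyMeasurable, this.trans_lt ENNReal.ofReal_lt_top⟩

theorem MomentBound.hasSubgaussianMGF [IsProbabilityMeasure P] (h : MomentBound P r K)
    (hK : 0 ≤ K) (hr : Measurable r) (hmean : ∫ ω, r ω ∂P = 0) :
    HasSubgaussianMGF r (Real.toNNReal (10 / 3 * K ^ 2)) P := by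
  have hint : ∀ s : ℝ, Integrable (fun ω => Real.exp (s * r ω) - 1 - s * r ω) P := by
    intro s
    refine ⟨by fun_prop, ?_⟩
    rw [hasFiniteIntegral_iff_ofReal (Filter.Eventually.of_forall fun ω => ?_)]
    · exact (h.lintegral_exp_sub_one_sub_le hK hr s).trans_lt ENNReal.ofReal_lt_top
    · have := Real.add_one_le_exp (s * r ω)
      simp only [Pi.zero_apply]
      linarith
  have hlin : ∀ s : ℝ, Integrable (fun ω => 1 + s * r ω) P := fun s =>
    (integrable_const 1).add ((h.integrable hr).const_mul s)
  have heq : ∀ s : ℝ, (fun ω => Real.exp (s * r ω)) =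
      fun ω => (Real.exp (s * r ω) - 1 - s * r ω) + (1 + s * r ω) := fun s => by
    funext ω; ring
  refine ⟨fun s => ?_, fun s => ?_⟩
  · rw [heq s]
    exact (hint s).add (hlin s)
  · rw [mgf, heq s, integral_add (hint s) (hlin s), integral_add (integrable_const 1)
      ((h.integrable hr).const_mul s), integral_const_mul, hmean]
    have h1 : ∫ ω, (Real.exp (s * r ω) - 1 - s * r ω) ∂P ≤
        Real.exp (5 / 3 * (s ^ 2 * K ^ 2)) - 1 := by
      rw [integral_eq_lintegral_of_nonneg_ae (Filter.Eventually.of_forall fun ω => ?_) (by fun_prop)]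
      · refine ENNReal.toReal_le_of_le_ofReal ?_ (h.lintegral_exp_sub_one_sub_le hK hr s)
        rw [sub_nonneg, Real.one_le_exp_iff]
        positivity
      · have := Real.add_one_le_exp (s * r ω)
        simp only [Pi.zero_apply]
        linarith
    rw [Real.coe_toNNReal _ (by positivity),
      show 10 / 3 * K ^ 2 * s ^ 2 / 2 = 5 / 3 * (s ^ 2 * K ^ 2) by ring]
    simp only [integral_const, probReal_univ, one_smul, mul_zero, add_zero]
    linarith

/-- If `K ≤ 0` then `r = 0` almost surely, and an atom contradicts anti-concentration at small `ε`.
-/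
theorem AntiConcentration.pos_of_momentBound [IsProbabilityMeasure P] {ρ : ℝ}
    (hρ : AntiConcentration P r ρ) (hr : Measurable r) (h : MomentBound P r K) : 0 < K := by
  by_contra! hK
  have h0 : r =ᵐ[P] 0 := by
    have := h 1 le_rfl
    rw [ENNReal.ofReal_one, ENNReal.ofReal_of_nonpos (by simpa using hK), nonpos_iff_eq_zero,
      eLpNorm_eq_zero_iff hr.aestronglyMeasurable one_ne_zero] at this
    exact this
  have h1 : ∀ ε : ℝ, 0 < ε → 1 ≤ 2 * ρ * ε := by
    intro ε hε
    refine le_trans (le_of_eq ?_) (hρ 0 ε hε)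
    rw [measureReal_def, (mem_ae_iff_prob_eq_one₀ (μ := P) (s := {ω | |r ω - 0| < ε})
      (by measurability)).mp ?_, ENNReal.toReal_one]
    filter_upwards [h0] with ω hω
    simpa [hω] using hε
  have h2 := h1 1 one_pos
  have h3 := h1 (1 / (4 * ρ)) (by apply one_div_pos.mpr; linarith)
  have hρ0 : 0 < ρ := by linarith
  field_simp at h3
  norm_num at h3

end Moments

/-! ### Volume of a double cone in the unit ball -/

theorem sqrt_mul_Gamma_le {x : ℝ} (hx : 1 / 2 < x) :
    √(x - 1 / 2) * Real.Gamma x ≤ Real.Gamma (x + 1 / 2) := by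
  have hs : 0 < x - 1 / 2 := by linarith
  have hG := Real.Gamma_pos_of_pos hs
  have hG2 : 0 < Real.Gamma (x + 1 / 2) := Real.Gamma_pos_of_pos (by linarith)
  have h := Real.Gamma_mul_add_mul_le_rpow_Gamma_mul_rpow_Gamma (a := 1 / 2) (b := 1 / 2) hs
    (show 0 < x + 1 / 2 by linarith) (by norm_num) (by norm_num) (by norm_num)
  rw [show 1 / 2 * (x - 1 / 2) + 1 / 2 * (x + 1 / 2) = x by ring, ← Real.sqrt_eq_rpow,
    ← Real.sqrt_eq_rpow] at h
  have hrec : Real.Gamma (x + 1 / 2) = (x - 1 / 2) * Real.Gamma (x - 1 / 2) := by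
    rw [← Real.Gamma_add_one hs.ne']
    congr 1
    ring
  calc √(x - 1 / 2) * Real.Gamma x
      ≤ √(x - 1 / 2) * (√(Real.Gamma (x - 1 / 2)) * √(Real.Gamma (x + 1 / 2))) := by gcongr
    _ = √(Real.Gamma (x + 1 / 2)) * √(Real.Gamma (x + 1 / 2)) := by
      rw [← mul_assoc, ← Real.sqrt_mul hs.le, ← hrec]
    _ = _ := Real.mul_self_sqrt hG2.le

/-- The volume of the unit ball of `ℝᵏ`. -/
def unitBallVolume (k : ℕ) : ℝ := √Real.pi ^ k / Real.Gamma (k / 2 + 1)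

theorem unitBallVolume_pos (k : ℕ) : 0 < unitBallVolume k :=
  div_pos (pow_pos (Real.sqrt_pos.mpr Real.pi_pos) _) (Real.Gamma_pos_of_pos (by positivity))

/-- Log-convexity of `Γ` in the form `√(x - 1/2) Γ(x) ≤ Γ(x + 1/2)` at `x = n/2 + 1`. It produces
the factor `√(2π(n + 1))` of the final bound. -/
theorem unitBallVolume_succ_le (n : ℕ) :
    unitBallVolume (n + 1) / √(2 * Real.pi * (n + 1)) ≤ unitBallVolume n / (n + 1) := by
  have h := sqrt_mul_Gamma_le (x := n / 2 + 1) (by linarith [(Nat.cast_nonneg n : (0 : ℝ) ≤ n)])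
  rw [show (n : ℝ) / 2 + 1 - 1 / 2 = (n + 1) / 2 by ring,
    show (n : ℝ) / 2 + 1 + 1 / 2 = ((n + 1 : ℕ) : ℝ) / 2 + 1 by push_cast; ring] at h
  have hG : 0 < Real.Gamma (n / 2 + 1) := Real.Gamma_pos_of_pos (by positivity)
  have hG2 : 0 < Real.Gamma (((n + 1 : ℕ) : ℝ) / 2 + 1) := Real.Gamma_pos_of_pos (by positivity)
  have hpi : 0 < √Real.pi := Real.sqrt_pos.mpr Real.pi_pos
  have hn : (0 : ℝ) < n + 1 := by positivity
  have hroot : √(2 * Real.pi * (n + 1)) = 2 * √Real.pi * √(((n : ℝ) + 1) / 2) := by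
    rw [show 2 * Real.pi * ((n : ℝ) + 1) = 2 ^ 2 * Real.pi * ((n + 1) / 2) by ring,
      Real.sqrt_mul (by positivity), Real.sqrt_mul (by positivity), Real.sqrt_sq (by norm_num)]
  have hs : √(((n : ℝ) + 1) / 2) ^ 2 = (n + 1) / 2 := Real.sq_sqrt (by positivity)
  have hs0 : 0 < √(((n : ℝ) + 1) / 2) := Real.sqrt_pos.mpr (by positivity)
  rw [hroot, unitBallVolume, unitBallVolume]
  set s := √(((n : ℝ) + 1) / 2)
  set G := Real.Gamma ((n : ℝ) / 2 + 1)
  set G' := Real.Gamma (((n + 1 : ℕ) : ℝ) / 2 + 1)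
  rw [show (n : ℝ) + 1 = 2 * s ^ 2 by linarith, div_div, div_div,
    div_le_div_iff₀ (by positivity) (by positivity), pow_succ]
  calc √Real.pi ^ n * √Real.pi * (G * (2 * s ^ 2))
      = √Real.pi ^ n * √Real.pi * 2 * s * (s * G) := by ring
    _ ≤ √Real.pi ^ n * √Real.pi * 2 * s * G' := by gcongr
    _ = _ := by ring

variable {n : ℕ}

/-- The double cone around the axis `x`, intersected with the unit ball. -/
def doubleCone (x : EuclideanSpace ℝ (Fin (n + 1))) (γ : ℝ) : Set (EuclideanSpace ℝ (Fin (n + 1))) :=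
  {y | ‖y‖ ≤ 1 ∧ γ * ‖y‖ ≤ |inner ℝ x y|}

theorem doubleCone_subset_closedBall (x : EuclideanSpace ℝ (Fin (n + 1))) (γ : ℝ) :
    doubleCone x γ ⊆ Metric.closedBall 0 1 := fun y hy => by simpa using hy.1

theorem measurableSet_doubleCone (x : EuclideanSpace ℝ (Fin (n + 1))) (γ : ℝ) :
    MeasurableSet (doubleCone x γ) :=
  ((isClosed_le (f := fun y => ‖y‖) (g := fun _ => 1) (by fun_prop) (by fun_prop)).inter
    (isClosed_le (f := fun y => γ * ‖y‖) (g := fun y => |inner ℝ x y|)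
      (by fun_prop) (by fun_prop))).measurableSet

/-- The pairs `(s, w)` with `s ∈ (-γ, γ]` in the double cone `‖w‖ ≤ |s| τ` of slope `τ`. -/
def slopeCone (n : ℕ) (γ τ : ℝ) : Set (ℝ × EuclideanSpace ℝ (Fin n)) :=
  {p | p.1 ∈ Set.Ioc (-γ) γ ∧ ‖p.2‖ ≤ |p.1| * τ}

theorem measurableSet_slopeCone (γ τ : ℝ) : MeasurableSet (slopeCone n γ τ) :=
  (measurable_fst measurableSet_Ioc).inter
    (isClosed_le (f := fun p : ℝ × EuclideanSpace ℝ (Fin n) => ‖p.2‖) (g := fun p => |p.1| * τ)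
      (by fun_prop) (by fun_prop)).measurableSet

theorem volume_slopeCone (hn : 1 ≤ n) {γ τ : ℝ} (hγ : 0 < γ) (hτ : 0 ≤ τ) :
    volume (slopeCone n γ τ) =
      ENNReal.ofReal (2 * γ ^ (n + 1) / (n + 1) * (τ ^ n * unitBallVolume n)) := by
  have : Nonempty (Fin n) := ⟨⟨0, hn⟩⟩
  have hω := unitBallVolume_pos n
  rw [Measure.volume_eq_prod, Measure.prod_apply (measurableSet_slopeCone γ τ)]
  have hslice : ∀ s : ℝ, volume (Prod.mk s ⁻¹' slopeCone n γ τ) =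
      (Set.Ioc (-γ) γ).indicator
        (fun s => ENNReal.ofReal (|s| ^ n * (τ ^ n * unitBallVolume n))) s := by
    intro s
    by_cases hs : s ∈ Set.Ioc (-γ) γ
    · rw [Set.indicator_of_mem hs]
      have : Prod.mk s ⁻¹' slopeCone n γ τ = Metric.closedBall 0 (|s| * τ) := by
        ext w
        simp only [slopeCone, Set.mem_preimage, Set.mem_ofPred_eq, mem_closedBall_zero_iff]
        exact and_iff_right hs
      rw [this, EuclideanSpace.volume_closedBall, Fintype.card_fin,
        ← ENNReal.ofReal_pow (by positivity), ← ENNReal.ofReal_mul (by positivity), mul_pow,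
        mul_assoc]
      rfl
    · rw [Set.indicator_of_notMem hs]
      have : Prod.mk s ⁻¹' slopeCone n γ τ = ∅ := by
        ext w
        simp only [slopeCone, Set.mem_preimage, Set.mem_ofPred_eq, Set.mem_empty_iff_false,
          iff_false]
        exact fun h => hs h.1
      rw [this, measure_empty]
  simp_rw [hslice]
  rw [lintegral_indicator measurableSet_Ioc,
    ← Set.Ioc_union_Ioc_eq_Ioc (neg_lt_zero.mpr hγ).le hγ.le,
    lintegral_union measurableSet_Ioc (Set.Ioc_disjoint_Ioc_of_le le_rfl)]
  have hhalf : ∀ a : ℝ, |a| = γ → ∫⁻ s in Set.uIoc 0 a,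
      ENNReal.ofReal (|s| ^ n * (τ ^ n * unitBallVolume n)) =
        ENNReal.ofReal (γ ^ (n + 1) / (n + 1) * (τ ^ n * unitBallVolume n)) := by
    intro a ha
    rw [← ofReal_integral_eq_lintegral_ofReal]
    · rw [integral_mul_const]
      have := integral_pow_abs_sub_uIoc (a := 0) (b := a) n
      simp only [sub_zero, ha] at this
      rw [this]
    · exact (Continuous.integrableOn_uIcc (by fun_prop)).mono_set Set.uIoc_subset_uIcc
    · exact Filter.Eventually.of_forall fun s => by positivity
  have h1 := hhalf γ (abs_of_pos hγ)
  have h2 := hhalf (-γ) (by rw [abs_neg, abs_of_pos hγ])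
  rw [Set.uIoc_of_le hγ.le] at h1
  rw [Set.uIoc_of_ge (neg_lt_zero.mpr hγ).le] at h2
  rw [h1, h2, ← ENNReal.ofReal_add (by positivity) (by positivity)]
  congr 1
  ring

theorem exists_measurePreserving_axis {x : EuclideanSpace ℝ (Fin (n + 1))} (hx : ‖x‖ = 1) :
    ∃ Φ : EuclideanSpace ℝ (Fin (n + 1)) → ℝ × EuclideanSpace ℝ (Fin n),
      MeasurePreserving Φ volume volume ∧
        ∀ y, (Φ y).1 = inner ℝ x y ∧ ‖y‖ ^ 2 = (Φ y).1 ^ 2 + ‖(Φ y).2‖ ^ 2 := by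
  obtain ⟨b, hb⟩ := Orthonormal.exists_orthonormalBasis_extension_of_card_eq
    (𝕜 := ℝ) (E := EuclideanSpace ℝ (Fin (n + 1))) (ι := Fin (n + 1)) (by simp)
    (v := fun _ => x) (s := {0}) (by
      rw [orthonormal_iff_ite]
      rintro ⟨i, hi⟩ ⟨j, hj⟩
      rw [Set.mem_singleton_iff] at hi hj
      subst hi hj
      simp [hx])
  have hb0 : b 0 = x := hb 0 rfl
  have h1 := b.measurePreserving_repr
  have h2 := PiLp.volume_preserving_ofLp (Fin (n + 1))
  have h3 := volume_preserving_piFinSuccAbove (fun _ : Fin (n + 1) => ℝ) 0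
  have h4 : MeasurePreserving (Prod.map (id : ℝ → ℝ)
      (WithLp.toLp 2 : (Fin n → ℝ) → EuclideanSpace ℝ (Fin n))) volume volume :=
    (MeasurePreserving.id volume).prod (PiLp.volume_preserving_toLp (Fin n))
  refine ⟨_, h4.comp (h3.comp (h2.comp h1)), fun y => ⟨?_, ?_⟩⟩
  · rw [← hb0, ← b.repr_apply_apply]
    rfl
  · rw [← b.repr.norm_map y, EuclideanSpace.real_norm_sq_eq, EuclideanSpace.real_norm_sq_eq,
      Fin.sum_univ_succ]
    rfl

theorem le_volume_doubleCone (hn : 1 ≤ n) {x : EuclideanSpace ℝ (Fin (n + 1))} (hx : ‖x‖ = 1)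
    {γ : ℝ} (hγ : 0 < γ) (hγ1 : γ ≤ 1) :
    ENNReal.ofReal (2 * (γ * √(1 - γ ^ 2) ^ n) / √(2 * Real.pi * (n + 1))) *
      volume (Metric.closedBall (0 : EuclideanSpace ℝ (Fin (n + 1))) 1) ≤
        volume (doubleCone x γ) := by
  obtain ⟨Φ, hΦ, hΦy⟩ := exists_measurePreserving_axis hx
  set σ := √(1 - γ ^ 2) with hσ
  have hσ2 : σ ^ 2 = 1 - γ ^ 2 := Real.sq_sqrt (by nlinarith)
  have hσ0 : 0 ≤ σ := Real.sqrt_nonneg _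
  -- Cutting the cone at height `γ` on each side leaves two straight cones with base radius `σ`; the
  -- spherical caps are discarded.
  have hsub : Φ ⁻¹' slopeCone n γ (σ / γ) ⊆ doubleCone x γ := by
    rintro y ⟨hy1, hy2⟩
    obtain ⟨h1, h2⟩ := hΦy y
    have habs : |(Φ y).1| ≤ γ := abs_le.mpr ⟨hy1.1.le, hy1.2⟩
    have h3 : ‖(Φ y).2‖ ^ 2 ≤ (|(Φ y).1| * (σ / γ)) ^ 2 := by gcongr
    have h4 : (γ * ‖y‖) ^ 2 ≤ |(Φ y).1| ^ 2 := by
      calc (γ * ‖y‖) ^ 2 = γ ^ 2 * (|(Φ y).1| ^ 2 + ‖(Φ y).2‖ ^ 2) := by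
            rw [mul_pow, h2, sq_abs]
        _ ≤ γ ^ 2 * (|(Φ y).1| ^ 2 + (|(Φ y).1| * (σ / γ)) ^ 2) := by gcongr
        _ = |(Φ y).1| ^ 2 * (γ ^ 2 + σ ^ 2) := by field_simp
        _ = _ := by rw [hσ2]; ring
    have h5 : γ * ‖y‖ ≤ |(Φ y).1| := (sq_le_sq₀ (by positivity) (by positivity)).mp h4
    refine ⟨?_, h1 ▸ h5⟩
    have h6 : γ * ‖y‖ ≤ γ * 1 := by linarith
    exact le_of_mul_le_mul_left h6 hγ
  refine le_trans ?_ (measure_mono hsub)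
  rw [hΦ.measure_preimage (measurableSet_slopeCone _ _).nullMeasurableSet,
    volume_slopeCone hn hγ (by positivity), EuclideanSpace.volume_closedBall, ENNReal.ofReal_one,
    one_pow, one_mul, Fintype.card_fin, ← ENNReal.ofReal_mul (by positivity)]
  refine ENNReal.ofReal_le_ofReal ?_
  have h := unitBallVolume_succ_le n
  calc 2 * (γ * σ ^ n) / √(2 * Real.pi * (n + 1)) *
        (√Real.pi ^ (n + 1) / Real.Gamma (((n + 1 : ℕ) : ℝ) / 2 + 1))
      = 2 * (γ * σ ^ n) * (unitBallVolume (n + 1) / √(2 * Real.pi * (n + 1))) := by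
        rw [unitBallVolume]; ring
    _ ≤ 2 * (γ * σ ^ n) * (unitBallVolume n / (n + 1)) := by gcongr
    _ = _ := by
        rw [div_pow, pow_succ]
        field_simp

/-- The weighted monomial `(|α| choose α)^{1/2} y^α`. -/
def weightedMonomial {n : ℕ} (α : Fin (n + 1) →₀ ℕ) (y : EuclideanSpace ℝ (Fin (n + 1))) : ℝ :=
  √(α.multinomial : ℝ) * α.prod fun j k => y j ^ k

theorem continuous_weightedMonomial {n : ℕ} (α : Fin (n + 1) →₀ ℕ) :
    Continuous (weightedMonomial α) := by
  unfold weightedMonomial Finsupp.prod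
  fun_prop

/-- The multinomial theorem for `(∑ y_j²)^e`. It makes the variance proxy of `f_i(y)` on the unit
ball no larger than that of one coefficient. -/
theorem sum_weightedMonomial_sq {n : ℕ} (e : ℕ) (y : EuclideanSpace ℝ (Fin (n + 1))) :
    ∑ α : exponents n e, weightedMonomial α.1 y ^ 2 = (‖y‖ ^ 2) ^ e := by
  rw [EuclideanSpace.real_norm_sq_eq, Finset.sum_pow_eq_sum_piAntidiag,
    Finset.sum_coe_sort (exponents n e) (fun α => weightedMonomial α y ^ 2)]
  refine Finset.sum_nbij' (fun α => ⇑α) (fun k => Finsupp.equivFunOnFinite.symm k) ?_ ?_ ?_ ?_ ?_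
  · intro α hα
    simpa [exponents] using hα
  · intro k hk
    simpa [exponents] using hk
  · intro α _
    exact Finsupp.equivFunOnFinite.symm_apply_apply α
  · intro k _
    rfl
  · intro α _
    rw [weightedMonomial, mul_pow, Real.sq_sqrt (Nat.cast_nonneg _)]
    congr 1
    · congr 1
      rw [Finsupp.multinomial, Nat.multinomial, Finsupp.sum_fintype _ _ (fun _ => rfl),
        Finsupp.prod_fintype _ _ (fun _ => rfl)]
      rfl
    · rw [Finsupp.prod_fintype _ _ (fun _ => pow_zero _), ← Finset.prod_pow]
      exact Finset.prod_congr rfl fun j _ => by rw [← pow_mul, ← pow_mul, mul_comm]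

section Sphere

variable {n q : ℕ} {d : Fin q → ℕ}

theorem continuous_evalTuple (f : HomogTuple n d) : Continuous (evalTuple f) := by
  refine continuous_pi fun i => ?_
  exact (MvPolynomial.continuous_eval _).comp (by fun_prop)

theorem norm_evalTuple_le_supNorm (f : HomogTuple n d) {y : EuclideanSpace ℝ (Fin (n + 1))}
    (hy : ‖y‖ = 1) : ‖evalTuple f y‖ ≤ supNorm f := by
  have hbdd : BddAbove (Set.range fun x : Metric.sphere (0 : EuclideanSpace ℝ (Fin (n + 1))) 1 =>
      ‖evalTuple f x‖) :=
    (isCompact_range (by have := continuous_evalTuple f; fun_prop)).bddAbove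
  exact le_ciSup hbdd ⟨y, by simpa using hy⟩

theorem supNorm_nonneg (f : HomogTuple n d) : 0 ≤ supNorm f :=
  Real.iSup_nonneg fun _ => norm_nonneg _

instance : Nonempty (Metric.sphere (0 : EuclideanSpace ℝ (Fin (n + 1))) 1) :=
  ⟨⟨EuclideanSpace.single 0 1, by simp⟩⟩

theorem exists_abs_eq_supNorm [Nonempty (Fin q)] (f : HomogTuple n d) :
    ∃ (x : EuclideanSpace ℝ (Fin (n + 1))) (i : Fin q), ‖x‖ = 1 ∧ |evalTuple f x i| = supNorm f := by
  have hc : Continuous fun x : Metric.sphere (0 : EuclideanSpace ℝ (Fin (n + 1))) 1 =>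
      ‖evalTuple f x‖ := by
    have := continuous_evalTuple f
    fun_prop
  obtain ⟨x, -, hx⟩ := isCompact_univ.exists_isMaxOn Set.univ_nonempty hc.continuousOn
  obtain ⟨i, hi⟩ := Finite.exists_max fun i => ‖evalTuple f x i‖
  refine ⟨x, i, by simp, le_antisymm ?_ ?_⟩
  · exact (norm_le_pi_norm (evalTuple f x) i).trans
      (norm_evalTuple_le_supNorm f (by simp))
  · refine ciSup_le fun y => (hx (Set.mem_univ y)).trans ?_
    exact (pi_norm_le_iff_of_nonneg (norm_nonneg _)).mpr hi

end Sphere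

/-! ### Averaging over the cone around a maximum point -/

section Average

variable {n : ℕ}

/-- The point of the unit sphere in the direction of `y`. -/
def direction (y : EuclideanSpace ℝ (Fin (n + 1))) : EuclideanSpace ℝ (Fin (n + 1)) := ‖y‖⁻¹ • y

theorem measurable_direction : Measurable (direction (n := n)) := by
  unfold direction
  fun_prop

theorem norm_direction {y : EuclideanSpace ℝ (Fin (n + 1))} (hy : y ≠ 0) : ‖direction y‖ = 1 := by
  rw [direction, norm_smul, norm_inv, norm_norm, inv_mul_cancel₀ (norm_ne_zero_iff.mpr hy)]

theorem norm_direction_le (y : EuclideanSpace ℝ (Fin (n + 1))) : ‖direction y‖ ≤ 1 := by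
  by_cases hy : y = 0
  · simp [direction, hy]
  · exact (norm_direction hy).le

theorem preimage_doubleCone {x : EuclideanSpace ℝ (Fin (n + 1))} (hx : ‖x‖ = 1) (γ : ℝ) :
    axisReflection x ⁻¹' doubleCone x γ = doubleCone x γ := by
  ext y
  simp only [doubleCone, Set.mem_preimage, Set.mem_ofPred_eq, LinearIsometryEquiv.norm_map,
    inner_axisReflection hx]

theorem cosh_add_div_two_le (a b : ℝ) :
    Real.cosh ((a + b) / 2) ≤ (Real.cosh a + Real.cosh b) / 2 := by
  have h : Real.cosh a + Real.cosh b = 2 * Real.cosh ((a + b) / 2) * Real.cosh ((a - b) / 2) := by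
    have ha : Real.cosh a = Real.cosh ((a + b) / 2 + (a - b) / 2) := by congr 1; ring
    have hb : Real.cosh b = Real.cosh ((a + b) / 2 - (a - b) / 2) := by congr 1; ring
    rw [ha, hb, Real.cosh_add, Real.cosh_sub]
    ring
  have h1 := Real.one_le_cosh ((a - b) / 2)
  have h2 := Real.cosh_pos ((a + b) / 2)
  rw [h]
  nlinarith

/-- The cone is invariant under the reflection, so the integrand may be averaged with its mirror
image; convexity of `cosh` then brings in the midpoint estimate. The aperture makes `N²(1 - |⟨x,
z⟩|) ≤ 1/4`, whence the factor `3/4`. -/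
theorem volume_mul_cosh_le_lintegral {f : MvPolynomial (Fin (n + 1)) ℝ} {N e : ℕ}
    (hN : 1 ≤ N) (hf : f.IsHomogeneous e) (he : e ≤ N) {x : EuclideanSpace ℝ (Fin (n + 1))}
    (hx : ‖x‖ = 1)
    (hmax : ∀ y : EuclideanSpace ℝ (Fin (n + 1)), ‖y‖ = 1 →
      |MvPolynomial.eval (fun j => y j) f| ≤ |MvPolynomial.eval (fun j => x j) f|)
    {t : ℝ} (ht : 0 ≤ t) (htx : t ≤ |MvPolynomial.eval (fun j => x j) f|) (s : ℝ) :
    volume (doubleCone x (1 - 1 / (4 * (N : ℝ) ^ 2))) * ENNReal.ofReal (Real.cosh (s * (3 / 4 * t)))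
      ≤ ∫⁻ y in doubleCone x (1 - 1 / (4 * (N : ℝ) ^ 2)),
        ENNReal.ofReal (Real.cosh (s * MvPolynomial.eval (fun j => direction y j) f)) := by
  set γ : ℝ := 1 - 1 / (4 * (N : ℝ) ^ 2) with hγ
  have hN' : (1 : ℝ) ≤ N := by exact_mod_cast hN
  have hN2 : (0 : ℝ) < (N : ℝ) ^ 2 := by positivity
  set H : EuclideanSpace ℝ (Fin (n + 1)) → ENNReal := fun y =>
    ENNReal.ofReal (Real.cosh (s * MvPolynomial.eval (fun j => direction y j) f)) with hH
  have hHm : Measurable H := by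
    have h1 : Measurable fun y : EuclideanSpace ℝ (Fin (n + 1)) =>
        MvPolynomial.eval (fun j => direction y j) f := by
      have h2 : Continuous fun y : EuclideanSpace ℝ (Fin (n + 1)) =>
        MvPolynomial.eval (fun j => y j) f := (MvPolynomial.continuous_eval _).comp (by fun_prop)
      exact h2.measurable.comp measurable_direction
    exact (Real.continuous_cosh.measurable.comp (h1.const_mul s)).ennreal_ofReal
  have hrefl : ∫⁻ y in doubleCone x γ, H (axisReflection x y) = ∫⁻ y in doubleCone x γ, H y := by
    have := (axisReflection x).measurePreserving.setLIntegral_comp_preimage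
      (measurableSet_doubleCone x γ) hHm
    rwa [preimage_doubleCone hx] at this
  have hpt : ∀ᵐ y ∂(volume : Measure (EuclideanSpace ℝ (Fin (n + 1)))), y ∈ doubleCone x γ →
      2 * ENNReal.ofReal (Real.cosh (s * (3 / 4 * t))) ≤ H y + H (axisReflection x y) := by
    filter_upwards [compl_mem_ae_iff.mpr
      (measure_singleton (μ := volume) (0 : EuclideanSpace ℝ (Fin (n + 1))))] with y hy0 hy
    have hy0 : y ≠ 0 := hy0
    have hR : direction (axisReflection x y) = axisReflection x (direction y) := by
      rw [direction, direction, LinearIsometryEquiv.norm_map, map_smul]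
    have hinner : γ ≤ |inner ℝ x (direction y)| := by
      have hpos := norm_pos_iff.mpr hy0
      rw [direction, inner_smul_right, abs_mul, abs_inv, abs_norm, ← div_eq_inv_mul,
        le_div_iff₀ hpos]
      exact hy.2
    have h34 : 3 / 4 ≤ 1 - (N : ℝ) ^ 2 * (1 - |inner ℝ x (direction y)|) := by
      have : (N : ℝ) ^ 2 * (1 - |inner ℝ x (direction y)|) ≤
          (N : ℝ) ^ 2 * (1 / (4 * (N : ℝ) ^ 2)) := by
        gcongr
        linarith
      have h4 : (N : ℝ) ^ 2 * (1 / (4 * (N : ℝ) ^ 2)) = 1 / 4 := by field_simp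
      linarith
    have hnear : 1 - 2 / (N : ℝ) ^ 2 ≤ |inner ℝ x (direction y)| := by
      refine le_trans ?_ hinner
      rw [hγ]
      have : 1 / (4 * (N : ℝ) ^ 2) ≤ 2 / (N : ℝ) ^ 2 := by
        rw [div_le_div_iff₀ (by positivity) hN2]
        nlinarith
      linarith
    have key := mul_abs_eval_le_abs_add hN hf he hx (norm_direction hy0) hmax hnear
    simp only [hH, hR]
    have htwo : ∀ r : ℝ, 2 * ENNReal.ofReal r = ENNReal.ofReal (2 * r) := fun r => by
      rw [ENNReal.ofReal_mul zero_le_two, ENNReal.ofReal_ofNat]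
    rw [← ENNReal.ofReal_add (Real.cosh_pos _).le (Real.cosh_pos _).le, htwo]
    refine ENNReal.ofReal_le_ofReal ?_
    set A := MvPolynomial.eval (fun j => direction y j) f
    set B := MvPolynomial.eval (fun j => axisReflection x (direction y) j) f
    have h5 : 3 / 4 * t ≤ |(A + B) / 2| := by
      refine le_trans ?_ key
      gcongr
    have h6 : Real.cosh (s * (3 / 4 * t)) ≤ Real.cosh ((s * A + s * B) / 2) := by
      rw [Real.cosh_le_cosh, show (s * A + s * B) / 2 = s * ((A + B) / 2) by ring, abs_mul s,
        abs_mul s, abs_of_nonneg (show 0 ≤ 3 / 4 * t by positivity)]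
      gcongr
    linarith [cosh_add_div_two_le (s * A) (s * B)]
  have h2 : 2 * (volume (doubleCone x γ) * ENNReal.ofReal (Real.cosh (s * (3 / 4 * t)))) ≤
      2 * ∫⁻ y in doubleCone x γ, H y := by
    calc 2 * (volume (doubleCone x γ) * ENNReal.ofReal (Real.cosh (s * (3 / 4 * t))))
        = ∫⁻ _ in doubleCone x γ, 2 * ENNReal.ofReal (Real.cosh (s * (3 / 4 * t))) := by
          rw [setLIntegral_const]; ring
      _ ≤ ∫⁻ y in doubleCone x γ, H y + H (axisReflection x y) :=
          setLIntegral_mono_ae' (measurableSet_doubleCone x γ) hpt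
      _ = 2 * ∫⁻ y in doubleCone x γ, H y := by
          rw [lintegral_add_left hHm, hrefl, two_mul]
  exact (ENNReal.mul_le_mul_iff_right two_ne_zero ENNReal.ofNat_ne_top).mp h2

end Average

/-! ### Exponential moments of random polynomials and Markov's inequality -/

section Random

variable {Ω : Type*} [MeasurableSpace Ω] {P : Measure Ω} {n q : ℕ} {d : Fin q → ℕ}

theorem evalTuple_eq_sum {f : HomogTuple n d} {i : Fin q} {c : exponents n (d i) → ℝ}
    (hf : (f i : MvPolynomial (Fin (n + 1)) ℝ) = ∑ α : exponents n (d i),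
      MvPolynomial.monomial α.1 (√(α.1.multinomial : ℝ) * c α))
    (y : EuclideanSpace ℝ (Fin (n + 1))) :
    evalTuple f y i = ∑ α : exponents n (d i), weightedMonomial α.1 y * c α := by
  rw [evalTuple, hf, map_sum]
  refine Finset.sum_congr rfl fun α _ => ?_
  rw [MvPolynomial.eval_monomial, weightedMonomial]
  ring

theorem IsDobro.pos [IsProbabilityMeasure P] {f : Ω → HomogTuple n d} {K ρ : ℝ}
    (hf : IsDobro P f K ρ) (i : Fin q) : 0 < K := by
  obtain ⟨c, -, hmeas, -, -, hsub, hK, hρ⟩ := hf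
  have hα : Finsupp.single 0 (d i) ∈ exponents n (d i) := by
    simp [exponents, Finset.mem_finsuppAntidiag]
  set j : Σ i : Fin q, exponents n (d i) := ⟨i, ⟨_, hα⟩⟩
  exact (hρ j).pos_of_momentBound (hmeas j) ((hsub j).momentBound (hK j))

theorem IsDobro.measurable_evalTuple {f : Ω → HomogTuple n d} {K ρ : ℝ}
    (hf : IsDobro P f K ρ) (i : Fin q) :
    Measurable fun p : Ω × EuclideanSpace ℝ (Fin (n + 1)) => evalTuple (f p.1) p.2 i := by
  obtain ⟨c, hc, hmeas, -⟩ := hf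
  have h : (fun p : Ω × EuclideanSpace ℝ (Fin (n + 1)) => evalTuple (f p.1) p.2 i) =
      fun p => ∑ α : exponents n (d i), weightedMonomial α.1 p.2 * c ⟨i, α⟩ p.1 := by
    funext p
    exact evalTuple_eq_sum (hc p.1 i) p.2
  rw [h]
  refine Finset.measurable_sum _ fun α _ => ?_
  exact ((continuous_weightedMonomial α.1).measurable.comp measurable_snd).mul
    ((hmeas _).comp measurable_fst)

theorem IsDobro.measurable_evalTuple_direction {f : Ω → HomogTuple n d} {K ρ : ℝ}
    (hf : IsDobro P f K ρ) (i : Fin q) :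
    Measurable fun p : Ω × EuclideanSpace ℝ (Fin (n + 1)) =>
      evalTuple (f p.1) (direction p.2) i := by
  have h : Measurable fun p : Ω × EuclideanSpace ℝ (Fin (n + 1)) => (p.1, direction p.2) :=
    measurable_fst.prodMk (measurable_direction.comp measurable_snd)
  have := (hf.measurable_evalTuple i).comp h
  exact this

theorem IsDobro.measurable_ofReal_cosh {f : Ω → HomogTuple n d} {K ρ : ℝ}
    (hf : IsDobro P f K ρ) (i : Fin q) (s : ℝ) :
    Measurable fun p : Ω × EuclideanSpace ℝ (Fin (n + 1)) =>
      ENNReal.ofReal (Real.cosh (s * evalTuple (f p.1) (direction p.2) i)) :=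
  ((hf.measurable_evalTuple_direction i).const_mul s).cosh.ennreal_ofReal

theorem IsDobro.measurable_supNorm {f : Ω → HomogTuple n d} {K ρ : ℝ}
    (hf : IsDobro P f K ρ) : Measurable fun ω => supNorm (f ω) := by
  obtain ⟨c, hc, hmeas, -⟩ := hf
  set G : Metric.sphere (0 : EuclideanSpace ℝ (Fin (n + 1))) 1 →
      ((Σ i : Fin q, exponents n (d i)) → ℝ) → ℝ := fun x a =>
    ‖fun i => ∑ α : exponents n (d i), weightedMonomial α.1 (x : EuclideanSpace ℝ _) * a ⟨i, α⟩‖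
    with hG
  -- The supremum is over an uncountable set; as a supremum of continuous functions of the
  -- coefficients it is lower semicontinuous, hence measurable.
  have hlsc : LowerSemicontinuous fun a => ⨆ x, G x a := by
    refine lowerSemicontinuous_ciSup (fun a => ?_) fun x => ?_
    · refine (isCompact_range ?_).bddAbove
      refine continuous_norm.comp (continuous_pi fun i => continuous_finsetSum _ fun α _ => ?_)
      exact ((continuous_weightedMonomial α.1).comp continuous_subtype_val).mul continuous_const
    · refine Continuous.lowerSemicontinuous ?_
      fun_prop
  have h : (fun ω => supNorm (f ω)) = (fun a => ⨆ x, G x a) ∘ fun ω j => c j ω := by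
    funext ω
    refine iSup_congr fun x => ?_
    congr 1
    funext i
    exact evalTuple_eq_sum (hc ω i) x
  rw [h]
  exact hlsc.measurable.comp (measurable_pi_lambda _ hmeas)

theorem IsDobro.lintegral_cosh_le [IsProbabilityMeasure P] {f : Ω → HomogTuple n d} {K ρ : ℝ}
    (hf : IsDobro P f K ρ) (i : Fin q) {y : EuclideanSpace ℝ (Fin (n + 1))} (hy : ‖y‖ ≤ 1)
    (s : ℝ) :
    ∫⁻ ω, ENNReal.ofReal (Real.cosh (s * evalTuple (f ω) y i)) ∂P ≤
      ENNReal.ofReal (Real.exp (5 / 3 * (s ^ 2 * K ^ 2))) := by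
  have hK0 := (hf.pos i).le
  obtain ⟨c, hc, hmeas, hind, hmean, hsub, hK, hρ⟩ := hf
  set k : NNReal := Real.toNNReal (10 / 3 * K ^ 2) with hk
  have hcj : ∀ α : exponents n (d i),
      HasSubgaussianMGF (c ⟨i, α⟩) k P := fun α =>
    ((hsub _).momentBound (hK _)).hasSubgaussianMGF hK0 (hmeas _) (hmean _)
  have hind' : iIndepFun (fun (α : exponents n (d i)) ω =>
      weightedMonomial α.1 y * c ⟨i, α⟩ ω) P :=
    (hind.precomp (g := fun α : exponents n (d i) => (⟨i, α⟩ : Σ i : Fin q, exponents n (d i)))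
      (fun α β h => by simpa using h)).comp (fun α r => weightedMonomial α.1 y * r)
      (fun α => by fun_prop)
  set w : exponents n (d i) → NNReal := fun α => ⟨weightedMonomial α.1 y ^ 2, sq_nonneg _⟩ with hw
  have hwsum : ((∑ α, w α : NNReal) : ℝ) = (‖y‖ ^ 2) ^ d i := by
    rw [NNReal.coe_sum, ← sum_weightedMonomial_sq]
    rfl
  have hsum : HasSubgaussianMGF (fun ω => ∑ α : exponents n (d i),
      weightedMonomial α.1 y * c ⟨i, α⟩ ω) (∑ α, w α * k) P :=
    HasSubgaussianMGF.sum_of_iIndepFun hind' (s := Finset.univ)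
      (fun α _ => (hcj α).const_mul (weightedMonomial α.1 y))
  have hX : (fun ω => ∑ α : exponents n (d i), weightedMonomial α.1 y * c ⟨i, α⟩ ω) =
      fun ω => evalTuple (f ω) y i := by
    funext ω
    exact (evalTuple_eq_sum (hc ω i) y).symm
  rw [hX] at hsum
  have hmgf : ∀ s : ℝ, mgf (fun ω => evalTuple (f ω) y i) P s ≤
      Real.exp (5 / 3 * (s ^ 2 * K ^ 2)) := by
    intro s
    refine (hsum.mgf_le s).trans (Real.exp_le_exp.mpr ?_)
    rw [← Finset.sum_mul, NNReal.coe_mul, hwsum, hk, Real.coe_toNNReal _ (by positivity)]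
    have h1 : (‖y‖ ^ 2) ^ d i ≤ 1 := pow_le_one₀ (by positivity) (pow_le_one₀ (norm_nonneg _) hy)
    calc (‖y‖ ^ 2) ^ d i * (10 / 3 * K ^ 2) * s ^ 2 / 2
        ≤ 1 * (10 / 3 * K ^ 2) * s ^ 2 / 2 := by gcongr
      _ = _ := by ring
  have hint := hsum.integrable_exp_mul
  have hcosh : (fun ω => Real.cosh (s * evalTuple (f ω) y i)) = fun ω =>
      (Real.exp (s * evalTuple (f ω) y i) + Real.exp (-s * evalTuple (f ω) y i)) / 2 := by
    funext ω
    rw [Real.cosh_eq, neg_mul]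
  rw [← ofReal_integral_eq_lintegral_ofReal]
  · refine ENNReal.ofReal_le_ofReal ?_
    rw [hcosh, integral_div, integral_add (hint s) (hint (-s))]
    have h1 := hmgf s
    have h2 := hmgf (-s)
    rw [mgf] at h1 h2
    rw [neg_sq] at h2
    linarith
  · rw [hcosh]
    exact ((hint s).add (hint (-s))).div_const 2
  · exact Filter.Eventually.of_forall fun ω => (Real.cosh_pos _).le

theorem IsDobro.measureReal_mul_le [IsProbabilityMeasure P] {f : Ω → HomogTuple n d} {K ρ : ℝ}
    (hf : IsDobro P f K ρ) (hn : 1 ≤ n) (hD : 1 ≤ maxDegree d) [Nonempty (Fin q)]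
    {t : ℝ} (ht : 0 ≤ t) (s : ℝ) {γ : ℝ} (hγ : γ = 1 - 1 / (4 * (maxDegree d : ℝ) ^ 2)) :
    γ * √(1 - γ ^ 2) ^ n / √(2 * Real.pi * (n + 1)) * Real.exp (s * (3 / 4 * t)) *
      P.real {ω | t ≤ supNorm (f ω)} ≤ q * Real.exp (5 / 3 * (s ^ 2 * K ^ 2)) := by
  have hD' : (1 : ℝ) ≤ maxDegree d := by exact_mod_cast hD
  have hle : 1 / (4 * (maxDegree d : ℝ) ^ 2) ≤ 1 / 4 := by
    apply one_div_le_one_div_of_le (by norm_num)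
    nlinarith
  have hγ0 : 0 < γ := by linarith
  have hγ1 : γ ≤ 1 := by
    have : 0 ≤ 1 / (4 * (maxDegree d : ℝ) ^ 2) := by positivity
    linarith
  set κ := γ * √(1 - γ ^ 2) ^ n / √(2 * Real.pi * (n + 1)) with hκ
  have hκ0 : 0 ≤ κ := by positivity
  set B := Metric.closedBall (0 : EuclideanSpace ℝ (Fin (n + 1))) 1 with hB
  set G : Ω → EuclideanSpace ℝ (Fin (n + 1)) → ENNReal := fun ω y =>
    ∑ i, ENNReal.ofReal (Real.cosh (s * evalTuple (f ω) (direction y) i)) with hG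
  have hGm : Measurable (Function.uncurry G) := by
    have hunc : Function.uncurry G = fun p : Ω × EuclideanSpace ℝ (Fin (n + 1)) => ∑ i,
        ENNReal.ofReal (Real.cosh (s * evalTuple (f p.1) (direction p.2) i)) := rfl
    rw [hunc]
    exact Finset.measurable_sum _ fun i _ => hf.measurable_ofReal_cosh i s
  have hB0 : volume B ≠ 0 := (Metric.measure_closedBall_pos volume _ one_pos).ne'
  have hBtop : volume B ≠ ⊤ := measure_closedBall_lt_top.ne
  have hupper : ∫⁻ ω, (∫⁻ y in B, G ω y) ∂P ≤
      volume B * ENNReal.ofReal (q * Real.exp (5 / 3 * (s ^ 2 * K ^ 2))) := by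
    rw [lintegral_lintegral_swap hGm.aemeasurable]
    calc ∫⁻ y in B, (∫⁻ ω, G ω y ∂P)
        ≤ ∫⁻ _ in B, ENNReal.ofReal (q * Real.exp (5 / 3 * (s ^ 2 * K ^ 2))) := by
          refine lintegral_mono fun y => ?_
          rw [lintegral_finsetSum]
          · refine (Finset.sum_le_sum fun i _ =>
              hf.lintegral_cosh_le i (norm_direction_le y) s).trans (le_of_eq ?_)
            rw [Finset.sum_const, Finset.card_univ, Fintype.card_fin, nsmul_eq_mul,
              ENNReal.ofReal_mul (Nat.cast_nonneg _), ENNReal.ofReal_natCast]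
          · intro i _
            have hp : Measurable fun ω : Ω => (ω, y) := measurable_id.prodMk measurable_const
            have := (hf.measurable_ofReal_cosh i s).comp hp
            exact this
      _ = _ := by rw [setLIntegral_const, mul_comm]
  have hlower : ∀ ω, t ≤ supNorm (f ω) →
      volume B * ENNReal.ofReal (κ * Real.exp (s * (3 / 4 * t))) ≤ ∫⁻ y in B, G ω y := by
    intro ω hω
    obtain ⟨x, i, hx, hxi⟩ := exists_abs_eq_supNorm (f ω)
    have hmax : ∀ y : EuclideanSpace ℝ (Fin (n + 1)), ‖y‖ = 1 →
        |evalTuple (f ω) y i| ≤ |evalTuple (f ω) x i| := fun y hy => by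
      rw [hxi]
      exact (norm_le_pi_norm (evalTuple (f ω) y) i).trans (norm_evalTuple_le_supNorm _ hy)
    have h1 := volume_mul_cosh_le_lintegral hD
      ((MvPolynomial.mem_homogeneousSubmodule _ _).mp (f ω i).2)
      (Finset.le_sup (f := d) (Finset.mem_univ i)) hx hmax ht (hω.trans_eq hxi.symm) s
    change _ * _ ≤ ∫⁻ y in doubleCone x (1 - 1 / (4 * (maxDegree d : ℝ) ^ 2)),
      ENNReal.ofReal (Real.cosh (s * evalTuple (f ω) (direction y) i)) at h1
    rw [← hγ] at h1
    have h2 := le_volume_doubleCone hn hx hγ0 hγ1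
    calc volume B * ENNReal.ofReal (κ * Real.exp (s * (3 / 4 * t)))
        -- The 2 from the two halves of the cone compensates the loss in `cosh v ≥ exp(v)/2`.
        ≤ volume B * ENNReal.ofReal (2 * κ * Real.cosh (s * (3 / 4 * t))) := by
          refine mul_le_mul_right (ENNReal.ofReal_le_ofReal ?_) _
          rw [Real.cosh_eq]
          nlinarith [mul_nonneg hκ0 (Real.exp_pos (-(s * (3 / 4 * t)))).le]
      _ = ENNReal.ofReal (2 * (γ * √(1 - γ ^ 2) ^ n) / √(2 * Real.pi * (n + 1))) * volume B *
            ENNReal.ofReal (Real.cosh (s * (3 / 4 * t))) := by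
          rw [ENNReal.ofReal_mul (by positivity), hκ, mul_div_assoc 2, ← mul_assoc]
          ring
      _ ≤ volume (doubleCone x γ) * ENNReal.ofReal (Real.cosh (s * (3 / 4 * t))) := by gcongr
      _ ≤ _ := h1
      _ ≤ ∫⁻ y in B, ENNReal.ofReal (Real.cosh (s * evalTuple (f ω) (direction y) i)) :=
          lintegral_mono_set (doubleCone_subset_closedBall x γ)
      _ ≤ _ := lintegral_mono fun y => Finset.single_le_sum
          (f := fun i => ENNReal.ofReal (Real.cosh (s * evalTuple (f ω) (direction y) i)))
          (fun _ _ => zero_le) (Finset.mem_univ i)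
  have hmarkov := mul_meas_ge_le_lintegral (μ := P) (hGm.lintegral_prod_right' (ν := volume.restrict B))
    (volume B * ENNReal.ofReal (κ * Real.exp (s * (3 / 4 * t))))
  have hfinal : volume B * (ENNReal.ofReal (κ * Real.exp (s * (3 / 4 * t))) *
      P {ω | t ≤ supNorm (f ω)}) ≤
      volume B * ENNReal.ofReal (q * Real.exp (5 / 3 * (s ^ 2 * K ^ 2))) := by
    rw [← mul_assoc]
    refine le_trans ?_ (hmarkov.trans hupper)
    gcongr
    exact hlower _
  rw [ENNReal.mul_le_mul_iff_right hB0 hBtop, ← ofReal_measureReal,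
    ← ENNReal.ofReal_mul (by positivity)] at hfinal
  exact (ENNReal.ofReal_le_ofReal_iff (by positivity)).mp hfinal

end Random

/-- The prefactor of the tail bound for a single polynomial. -/
def tailFactor (n D : ℕ) : ℝ :=
  √(2 * Real.pi) * √((n : ℝ) + 1) * (Real.exp 1 * (D : ℝ) / 2) ^ n

theorem log_tailFactor {n D : ℕ} (hD : 1 ≤ D) :
    Real.log (tailFactor n D) =
      Real.log (2 * Real.pi * (n + 1)) / 2 + n * (1 + Real.log D - Real.log 2) := by
  have hD' : (0 : ℝ) < D := by exact_mod_cast hD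
  have hpi := Real.pi_pos
  rw [tailFactor, ← Real.sqrt_mul (by positivity), Real.log_mul (by positivity) (by positivity),
    Real.log_sqrt (by positivity), Real.log_pow, Real.log_div (by positivity) (by norm_num),
    Real.log_mul (Real.exp_pos 1).ne' hD'.ne', Real.log_exp]

theorem tailFactor_pos {n D : ℕ} (hD : 1 ≤ D) : 0 < tailFactor n D := by
  have hD' : (0 : ℝ) < D := by exact_mod_cast hD
  have hpi := Real.pi_pos
  unfold tailFactor
  positivity

theorem log_eight_le {n : ℕ} (hn : 1 ≤ n) : 3 * Real.log 2 ≤ Real.log (2 * Real.pi * (n + 1)) := by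
  have hn' : (1 : ℝ) ≤ n := by exact_mod_cast hn
  have h8 : 3 * Real.log 2 = Real.log 8 := by
    rw [show (8 : ℝ) = 2 ^ 3 by norm_num, Real.log_pow]; norm_num
  rw [h8]
  refine Real.log_le_log (by norm_num) ?_
  nlinarith [Real.pi_gt_three]

/-- In logarithms, the surplus exponent `139/320` pays for `-log γ ≤ 1/3` through the square-root
factor, and for `1 - γ² ≥ 7/(16D²)` through the `n`-th power. -/
theorem inv_coneFraction_le {n D : ℕ} (hn : 1 ≤ n) (hD : 1 ≤ D) {γ : ℝ}
    (hγ : γ = 1 - 1 / (4 * (D : ℝ) ^ 2)) :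
    (γ * √(1 - γ ^ 2) ^ n / √(2 * Real.pi * (n + 1)))⁻¹ ≤
      tailFactor n D * Real.exp (139 / 320 * Real.log (tailFactor n D)) := by
  have hn' : (1 : ℝ) ≤ n := by exact_mod_cast hn
  have hD' : (1 : ℝ) ≤ D := by exact_mod_cast hD
  have hD2 : (1 : ℝ) ≤ (D : ℝ) ^ 2 := one_le_pow₀ hD'
  have hpi := Real.pi_pos
  have hle : 1 / (4 * (D : ℝ) ^ 2) ≤ 1 / 4 := one_div_le_one_div_of_le (by norm_num) (by linarith)
  have hpos : 0 < 1 / (4 * (D : ℝ) ^ 2) := by positivity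
  have hγ34 : 3 / 4 ≤ γ := by linarith
  have hσ : 7 / (16 * (D : ℝ) ^ 2) ≤ 1 - γ ^ 2 := by
    have h1 : 1 - γ ^ 2 = 1 / (4 * (D : ℝ) ^ 2) * (2 - 1 / (4 * (D : ℝ) ^ 2)) := by rw [hγ]; ring
    have h2 : 7 / (16 * (D : ℝ) ^ 2) = 1 / (4 * (D : ℝ) ^ 2) * (2 - 1 / 4) := by
      field_simp
      norm_num
    rw [h1, h2]
    gcongr
  have hσ0 : 0 < 1 - γ ^ 2 := lt_of_lt_of_le (by positivity) hσ
  have hσs : 0 < √(1 - γ ^ 2) := Real.sqrt_pos.mpr hσ0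
  have hN := tailFactor_pos (n := n) hD
  have hκ : 0 < γ * √(1 - γ ^ 2) ^ n / √(2 * Real.pi * (n + 1)) := by positivity
  rw [← Real.log_le_log_iff (inv_pos.mpr hκ) (by positivity), Real.log_inv,
    Real.log_mul hN.ne' (Real.exp_pos _).ne', Real.log_exp, Real.log_div (by positivity)
    (by positivity), Real.log_mul (by positivity) (by positivity), Real.log_pow,
    Real.log_sqrt hσ0.le, Real.log_sqrt (by positivity), log_tailFactor hD]
  have hlogD : 0 ≤ Real.log D := Real.log_nonneg hD'
  have hlogγ : -(1 / 3) ≤ Real.log γ := by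
    have h1 := Real.one_sub_inv_le_log_of_pos (show 0 < γ by linarith)
    have h2 : γ⁻¹ ≤ (3 / 4)⁻¹ := inv_anti₀ (by norm_num) hγ34
    norm_num at h2
    linarith
  have hlog167 : Real.log (16 / 7) ≤ 6 / 5 * Real.log 2 := by
    have h1 : Real.log ((16 / 7) ^ 5) ≤ Real.log (2 ^ 6) :=
      Real.log_le_log (by norm_num) (by norm_num)
    rw [Real.log_pow, Real.log_pow] at h1
    push_cast at h1
    linarith
  have hlogσ : -(6 / 5 * Real.log 2) - 2 * Real.log D ≤ Real.log (1 - γ ^ 2) := by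
    have h1 := Real.log_le_log (by positivity) hσ
    have h2 : Real.log (7 / (16 * (D : ℝ) ^ 2)) = -Real.log (16 / 7) - 2 * Real.log D := by
      rw [show 7 / (16 * (D : ℝ) ^ 2) = (16 / 7 * (D : ℝ) ^ 2)⁻¹ by field_simp, Real.log_inv,
        Real.log_mul (by norm_num) (by positivity), Real.log_pow]
      push_cast
      ring
    linarith
  have hlog8 := log_eight_le hn
  have hl2 := Real.log_two_lt_d9
  have hl2' := Real.log_two_gt_d9
  set L := Real.log (2 * Real.pi * (n + 1))
  have hmain : 0 ≤ (n : ℝ) * (Real.log (1 - γ ^ 2) / 2 +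
      459 / 320 * (1 + Real.log D - Real.log 2)) := by
    refine mul_nonneg (by linarith) ?_
    linarith
  linarith

/-! ### The tail bound -/

section Tail

variable {Ω : Type*} [MeasurableSpace Ω] {P : Measure Ω} [IsProbabilityMeasure P]
  {n q : ℕ} {d : Fin q → ℕ} {f : Ω → HomogTuple n d} {K ρ : ℝ}

theorem IsDobro.measureReal_le_mul_exp (hf : IsDobro P f K ρ) (hn : 1 ≤ n)
    (hD : 1 ≤ maxDegree d) [Nonempty (Fin q)] {t : ℝ} (ht : 0 < t) :
    P.real {ω | t ≤ supNorm (f ω)} ≤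
      q * tailFactor n (maxDegree d) * Real.exp (-t ^ 2 / (17 * K ^ 2)) := by
  obtain ⟨i⟩ := ‹Nonempty (Fin q)›
  have : Nonempty (Fin q) := ⟨i⟩
  have hK := hf.pos i
  have hq : (1 : ℝ) ≤ q := by exact_mod_cast i.pos
  set N := tailFactor n (maxDegree d) with hNdef
  have hN : 0 < N := tailFactor_pos hD
  set T := t ^ 2 / K ^ 2 with hT
  have hTe : -t ^ 2 / (17 * K ^ 2) = -(T / 17) := by rw [hT]; field_simp
  rw [hTe]
  -- In the first case the claimed bound is at least 1.
  rcases le_or_gt (T / 17) (Real.log N) with hcase | hcase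
  · refine measureReal_le_one.trans ?_
    have h1 : 1 ≤ N * Real.exp (-(T / 17)) := by
      rw [← Real.exp_log hN, ← Real.exp_add, Real.one_le_exp_iff]
      linarith
    rw [mul_assoc]
    nlinarith
  set γ : ℝ := 1 - 1 / (4 * (maxDegree d : ℝ) ^ 2) with hγ
  -- This `s` minimises `5/3 s²K² - 3/4 s t`, with minimum `-27/320 T`.
  have h1 := hf.measureReal_mul_le hn hD ht.le (9 * t / (40 * K ^ 2)) hγ
  have h2 := inv_coneFraction_le hn hD hγ
  set κ := γ * √(1 - γ ^ 2) ^ n / √(2 * Real.pi * (n + 1)) with hκdef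
  have hκ : 0 < κ := by
    have hD' : (1 : ℝ) ≤ maxDegree d := by exact_mod_cast hD
    have hle : 1 / (4 * (maxDegree d : ℝ) ^ 2) ≤ 1 / 4 :=
      one_div_le_one_div_of_le (by norm_num) (by nlinarith)
    have hpos : 0 < 1 / (4 * (maxDegree d : ℝ) ^ 2) := by positivity
    have hγ0 : 0 < γ := by linarith
    have hσ : 0 < √(1 - γ ^ 2) := Real.sqrt_pos.mpr (by nlinarith)
    have := Real.pi_pos
    positivity
  have he1 : 9 * t / (40 * K ^ 2) * (3 / 4 * t) = 27 / 160 * T := by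
    rw [hT]; field_simp; norm_num
  have he2 : 5 / 3 * ((9 * t / (40 * K ^ 2)) ^ 2 * K ^ 2) = 27 / 320 * T := by
    rw [hT]; field_simp; norm_num
  rw [he1, he2, ← le_div_iff₀' (by positivity)] at h1
  refine h1.trans ?_
  calc q * Real.exp (27 / 320 * T) / (κ * Real.exp (27 / 160 * T))
      = q * κ⁻¹ * Real.exp (27 / 320 * T - 27 / 160 * T) := by
        rw [Real.exp_sub]; field_simp
    _ ≤ q * (N * Real.exp (139 / 320 * Real.log N)) * Real.exp (27 / 320 * T - 27 / 160 * T) := by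
        gcongr
    _ = q * N * Real.exp (139 / 320 * Real.log N + (27 / 320 * T - 27 / 160 * T)) := by
        rw [Real.exp_add]; ring
    -- Since `log N < T/17` and `139 = 27 · 17 - 320`, the exponent is at most `-T/17`.
    _ ≤ q * N * Real.exp (-(T / 17)) := by
        gcongr
        linarith

theorem log_mul_tailFactor_le {n q D : ℕ} (hn : 1 ≤ n) (hD : 1 ≤ D) (hq : 1 ≤ q)
    (hqn : q ≤ n + 1) :
    Real.log (q * tailFactor n D) ≤ 3 * (n * Real.log (Real.exp 1 * D)) := by
  have hn' : (1 : ℝ) ≤ n := by exact_mod_cast hn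
  have hD' : (1 : ℝ) ≤ D := by exact_mod_cast hD
  have hq' : (1 : ℝ) ≤ q := by exact_mod_cast hq
  have hqn' : (q : ℝ) ≤ n + 1 := by exact_mod_cast hqn
  have hpi := Real.pi_pos
  rw [Real.log_mul (by positivity) (tailFactor_pos hD).ne', log_tailFactor hD,
    Real.log_mul (by positivity : 2 * Real.pi ≠ 0) (by positivity : (n : ℝ) + 1 ≠ 0),
    Real.log_mul (Real.exp_pos 1).ne' (by positivity), Real.log_exp]
  have h1 : Real.log q ≤ Real.log (n + 1) := Real.log_le_log (by positivity) hqn'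
  have h2 : Real.log ((n : ℝ) + 1) ≤ n := by
    have := Real.log_le_sub_one_of_pos (show (0 : ℝ) < n + 1 by positivity)
    linarith
  have h3 : Real.log (2 * Real.pi) ≤ 3 * Real.log 2 := by
    have h8 : 3 * Real.log 2 = Real.log 8 := by
      rw [show (8 : ℝ) = 2 ^ 3 by norm_num, Real.log_pow]; norm_num
    rw [h8]
    exact Real.log_le_log (by positivity) (by linarith [Real.pi_le_four])
  have hlogD : 0 ≤ Real.log D := Real.log_nonneg hD'
  have hl2 := Real.log_two_lt_d9
  have hl2' := Real.log_two_gt_d9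
  have h4 : 0 ≤ (n : ℝ) * Real.log D := by positivity
  have h5 : (n : ℝ) * (1 + Real.log D - Real.log 2) ≤
      n + n * Real.log D - n * (1 / 2) := by nlinarith
  nlinarith

end Tail

/-! ### Moments from the tail bound -/

section Moments

variable {Ω : Type*} [MeasurableSpace Ω] {P : Measure Ω} [IsProbabilityMeasure P]

/-- Layer-cake formula for `exp(Z/2) - 1`: the integral of `C exp(-t) · exp(t/2)/2` over `t > 0` is
`C`. -/
theorem lintegral_exp_half_le {Z : Ω → ℝ} (hZ : Measurable Z) (hZ0 : ∀ ω, 0 ≤ Z ω) {C : ℝ}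
    (hC : 0 ≤ C) (htail : ∀ z : ℝ, 0 < z → P.real {ω | z ≤ Z ω} ≤ C * Real.exp (-z)) :
    ∫⁻ ω, ENNReal.ofReal (Real.exp (Z ω / 2)) ∂P ≤ ENNReal.ofReal (1 + C) := by
  have hderiv : ∀ x : ℝ, HasDerivAt (fun x : ℝ => Real.exp (x / 2)) (Real.exp (x / 2) / 2) x := by
    intro x
    have := ((hasDerivAt_id x).div_const 2).exp
    simpa [div_eq_mul_inv] using this
  have hcont : Continuous fun x : ℝ => Real.exp (x / 2) / 2 := by fun_prop
  have hFTC : ∀ z : ℝ, ∫ t in (0 : ℝ)..z, Real.exp (t / 2) / 2 = Real.exp (z / 2) - 1 := by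
    intro z
    rw [intervalIntegral.integral_eq_sub_of_hasDerivAt (fun x _ => hderiv x)
      (hcont.intervalIntegrable _ _)]
    simp
  have hlayer := lintegral_comp_eq_lintegral_meas_le_mul_of_measurable P hZ0 hZ
    (fun t _ => hcont.intervalIntegrable 0 t) hcont.measurable (fun t _ => by positivity)
  simp_rw [hFTC] at hlayer
  have hint : IntegrableOn (fun t : ℝ => C / 2 * Real.exp (-(1 / 2) * t)) (Set.Ioi 0) :=
    (integrableOn_exp_mul_Ioi (by norm_num) 0).const_mul _
  have hval : ∫ t in Set.Ioi (0 : ℝ), C / 2 * Real.exp (-(1 / 2) * t) = C := by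
    rw [integral_const_mul, integral_exp_mul_Ioi (by norm_num)]
    norm_num
  calc ∫⁻ ω, ENNReal.ofReal (Real.exp (Z ω / 2)) ∂P
      = ∫⁻ ω, (1 + ENNReal.ofReal (Real.exp (Z ω / 2) - 1)) ∂P := by
        refine lintegral_congr fun ω => ?_
        have h1 : 0 ≤ Real.exp (Z ω / 2) - 1 := by
          rw [sub_nonneg, Real.one_le_exp_iff]
          linarith [hZ0 ω]
        rw [← ENNReal.ofReal_one, ← ENNReal.ofReal_add zero_le_one h1]
        congr 1
        ring
    _ = 1 + ∫⁻ t in Set.Ioi 0, P {ω | t ≤ Z ω} * ENNReal.ofReal (Real.exp (t / 2) / 2) := by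
        rw [lintegral_add_left measurable_const, hlayer]
        simp
    _ ≤ 1 + ∫⁻ t in Set.Ioi (0 : ℝ), ENNReal.ofReal (C / 2 * Real.exp (-(1 / 2) * t)) := by
        refine add_le_add_right (setLIntegral_mono' measurableSet_Ioi fun t ht => ?_) 1
        rw [← ofReal_measureReal, ← ENNReal.ofReal_mul measureReal_nonneg]
        refine ENNReal.ofReal_le_ofReal ?_
        calc P.real {ω | t ≤ Z ω} * (Real.exp (t / 2) / 2)
            ≤ C * Real.exp (-t) * (Real.exp (t / 2) / 2) := by
              gcongr
              exact htail t ht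
          _ = C / 2 * (Real.exp (-t) * Real.exp (t / 2)) := by ring
          _ = _ := by
              rw [← Real.exp_add]
              congr 2
              ring
    _ = ENNReal.ofReal (1 + C) := by
        rw [← ofReal_integral_eq_lintegral_ofReal hint
          (Filter.Eventually.of_forall fun t => by positivity), hval,
          ENNReal.ofReal_add zero_le_one hC, ENNReal.ofReal_one]

theorem rpow_le_mul_exp_half {z s : ℝ} (hz : 0 ≤ z) (hs : 0 < s) :
    z ^ s ≤ (2 * s / Real.exp 1) ^ s * Real.exp (z / 2) := by
  have h1 : z ≤ 2 * s / Real.exp 1 * Real.exp (z / (2 * s)) := by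
    have h2 := Real.add_one_le_exp (z / (2 * s) - 1)
    rw [Real.exp_sub, sub_add_cancel, div_le_iff₀ (by positivity)] at h2
    calc z ≤ Real.exp (z / (2 * s)) / Real.exp 1 * (2 * s) := h2
      _ = _ := by ring
  calc z ^ s ≤ (2 * s / Real.exp 1 * Real.exp (z / (2 * s))) ^ s :=
        Real.rpow_le_rpow hz h1 hs.le
    _ = _ := by
        rw [Real.mul_rpow (by positivity) (by positivity), ← Real.exp_mul]
        congr 2
        field_simp

/-- Rescaling `X²` by `17K²L` gives `Z` with tail `exp(3 - z)`, so `exp(Z/2)` has mean at most `1 +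
e³ ≤ 22` and dominates every power of `Z`. The constant is `√(17/e) · 22 ≤ 2.52 · 22 ≤ 63`. -/
theorem moment_le_of_tail {X : Ω → ℝ} (hX : Measurable X) (hX0 : ∀ ω, 0 ≤ X ω) {K L M l : ℝ}
    (hK : 0 < K) (hL : 1 ≤ L) (hM : 0 < M) (hML : Real.log M ≤ 3 * L) (hl : 1 ≤ l)
    (htail : ∀ t : ℝ, 0 < t → P.real {ω | t ≤ X ω} ≤ M * Real.exp (-t ^ 2 / (17 * K ^ 2))) :
    Integrable (fun ω => X ω ^ l) P ∧
      (∫ ω, X ω ^ l ∂P) ^ (1 / l) ≤ 63 * K * √(L * l) := by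
  have hl0 : 0 < l := by linarith
  have hL0 : 0 < L := by linarith
  set A := 17 * K ^ 2 * L with hA
  have hA0 : 0 < A := by positivity
  set Z : Ω → ℝ := fun ω => X ω ^ 2 / A with hZ
  have hZm : Measurable Z := by fun_prop
  have hZ0 : ∀ ω, 0 ≤ Z ω := fun ω => by positivity
  have hZtail : ∀ z : ℝ, 0 < z → P.real {ω | z ≤ Z ω} ≤ Real.exp 3 * Real.exp (-z) := by
    intro z hz
    have hset : {ω | z ≤ Z ω} = {ω | √(A * z) ≤ X ω} := by
      ext ω
      simp only [Set.mem_ofPred_eq, hZ]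
      rw [le_div_iff₀' hA0, Real.sqrt_le_left (hX0 ω)]
    rw [hset, ← Real.exp_add]
    -- For `z ≤ 3` the bound is trivial; for `z ≥ 3`, `M exp(-Lz) ≤ exp(-L(z - 3)) ≤ exp(-(z - 3))`
    -- because `L ≥ 1`.
    rcases le_total z 3 with h | h
    · exact measureReal_le_one.trans (Real.one_le_exp_iff.mpr (by linarith))
    · refine (htail _ (Real.sqrt_pos.mpr (by positivity))).trans ?_
      rw [Real.sq_sqrt (by positivity), ← Real.exp_log hM, ← Real.exp_add]
      refine Real.exp_le_exp.mpr ?_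
      have h1 : -(A * z) / (17 * K ^ 2) = -(L * z) := by rw [hA]; field_simp
      rw [h1]
      nlinarith
  have hexp := lintegral_exp_half_le hZm hZ0 (Real.exp_pos 3).le hZtail
  have he3 : 1 + Real.exp 3 ≤ 22 := by
    have h1 : Real.exp 3 = Real.exp 1 ^ 3 := by rw [← Real.exp_nat_mul]; norm_num
    have h2 : Real.exp 1 ^ 3 ≤ 2.7182818286 ^ 3 := by
      gcongr
      exact Real.exp_one_lt_d9.le
    rw [h1]
    norm_num at h2 ⊢
    linarith
  have hpt : ∀ ω, X ω ^ l ≤ (A * (l / Real.exp 1)) ^ (l / 2) * Real.exp (Z ω / 2) := by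
    intro ω
    have h1 : X ω ^ l = A ^ (l / 2) * Z ω ^ (l / 2) := by
      rw [← Real.mul_rpow hA0.le (hZ0 ω), hZ, mul_div_cancel₀ _ hA0.ne', ← Real.rpow_natCast,
        ← Real.rpow_mul (hX0 ω)]
      congr 1
      push_cast
      ring
    have h2 := rpow_le_mul_exp_half (hZ0 ω) (show 0 < l / 2 by linarith)
    rw [mul_div_cancel₀ _ two_ne_zero] at h2
    rw [h1, Real.mul_rpow hA0.le (by positivity), mul_assoc]
    gcongr
  set B := (A * (l / Real.exp 1)) ^ (l / 2) with hB
  have hB0 : 0 ≤ B := by positivity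
  have hXl0 : ∀ ω, 0 ≤ X ω ^ l := fun ω => Real.rpow_nonneg (hX0 ω) l
  have hlint : ∫⁻ ω, ENNReal.ofReal (X ω ^ l) ∂P ≤ ENNReal.ofReal (B * 22) := by
    calc ∫⁻ ω, ENNReal.ofReal (X ω ^ l) ∂P
        ≤ ∫⁻ ω, ENNReal.ofReal B * ENNReal.ofReal (Real.exp (Z ω / 2)) ∂P := by
          refine lintegral_mono fun ω => ?_
          rw [← ENNReal.ofReal_mul hB0]
          exact ENNReal.ofReal_le_ofReal (hpt ω)
      _ = ENNReal.ofReal B * ∫⁻ ω, ENNReal.ofReal (Real.exp (Z ω / 2)) ∂P :=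
          lintegral_const_mul _ (by fun_prop)
      _ ≤ ENNReal.ofReal B * ENNReal.ofReal 22 := by
          gcongr
          exact hexp.trans (ENNReal.ofReal_le_ofReal he3)
      _ = _ := (ENNReal.ofReal_mul hB0).symm
  have hmeas : Measurable fun ω => X ω ^ l := by fun_prop
  refine ⟨⟨hmeas.aestronglyMeasurable, ?_⟩, ?_⟩
  · rw [hasFiniteIntegral_iff_ofReal (Filter.Eventually.of_forall hXl0)]
    exact hlint.trans_lt ENNReal.ofReal_lt_top
  have hI : ∫ ω, X ω ^ l ∂P ≤ B * 22 := by
    rw [integral_eq_lintegral_of_nonneg_ae (Filter.Eventually.of_forall hXl0)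
      hmeas.aestronglyMeasurable]
    exact ENNReal.toReal_le_of_le_ofReal (by positivity) hlint
  have hBroot : B ^ (1 / l) = √(A * (l / Real.exp 1)) := by
    rw [hB, ← Real.rpow_mul (by positivity), Real.sqrt_eq_rpow]
    congr 1
    field_simp
  have h22 : (22 : ℝ) ^ (1 / l) ≤ 22 := by
    conv_rhs => rw [← Real.rpow_one 22]
    exact Real.rpow_le_rpow_of_exponent_le (by norm_num) ((div_le_one hl0).mpr hl)
  have hroot : √(A * (l / Real.exp 1)) ≤ 2.52 * K * √(L * l) := by
    rw [Real.sqrt_le_left (by positivity), mul_pow, mul_pow, Real.sq_sqrt (by positivity), hA,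
      mul_div_assoc', div_le_iff₀ (by positivity)]
    have he := Real.exp_one_gt_d9
    calc 17 * K ^ 2 * L * l ≤ 2.52 ^ 2 * K ^ 2 * (L * l) * 2.7182818283 := by
          have : 0 ≤ K ^ 2 * (L * l) := by positivity
          nlinarith
      _ ≤ _ := by gcongr
  calc (∫ ω, X ω ^ l ∂P) ^ (1 / l) ≤ (B * 22) ^ (1 / l) :=
        Real.rpow_le_rpow (integral_nonneg hXl0) hI (by positivity)
    _ = √(A * (l / Real.exp 1)) * (22 : ℝ) ^ (1 / l) := by
        rw [Real.mul_rpow hB0 (by norm_num), hBroot]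
    _ ≤ 2.52 * K * √(L * l) * 22 := by gcongr
    _ ≤ 63 * K * √(L * l) := by
        have : 0 ≤ K * √(L * l) := by positivity
        nlinarith

end Moments

end Dobro

end

theorem proposition4p32 {Ω : Type*} [MeasurableSpace Ω] (P : Measure Ω) [IsProbabilityMeasure P]
    (n q : ℕ) (hn : 1 ≤ n) (d : Fin q → ℕ) (hD : 1 ≤ Dobro.maxDegree d)
    (f : Ω → Dobro.HomogTuple n d) (K ρ : ℝ) (hf : Dobro.IsDobro P f K ρ) :
    (∀ t : ℝ, 0 < t →
      P.real {ω | t ≤ Dobro.supNorm (f ω)} ≤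
        q * √(2 * Real.pi) * √((n : ℝ) + 1) *
          (Real.exp 1 * (Dobro.maxDegree d : ℝ) / 2) ^ n * Real.exp (-t ^ 2 / (17 * K ^ 2))) ∧
    (q ≤ n + 1 → ∀ l : ℝ, 1 ≤ l →
      Integrable (fun ω => Dobro.supNorm (f ω) ^ l) P ∧
      (∫ ω, Dobro.supNorm (f ω) ^ l ∂P) ^ (1 / l) ≤
        63 * K * √(n * Real.log (Real.exp 1 * (Dobro.maxDegree d : ℝ)) * l)) := by
  -- The maximum degree of an empty tuple is 0, so `1 ≤ maxDegree d` excludes it.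
  have hq : 1 ≤ q := by
    by_contra h
    obtain rfl : q = 0 := by omega
    simp [Dobro.maxDegree] at hD
  have : Nonempty (Fin q) := ⟨⟨0, hq⟩⟩
  have htail := fun (t : ℝ) (ht : 0 < t) => hf.measureReal_le_mul_exp hn hD ht
  refine ⟨fun t ht => (htail t ht).trans_eq ?_, fun hqn l hl => ?_⟩
  · rw [Dobro.tailFactor]
    ring
  · have hn' : (1 : ℝ) ≤ n := by exact_mod_cast hn
    have hD' : (1 : ℝ) ≤ Dobro.maxDegree d := by exact_mod_cast hD
    have hq' : (1 : ℝ) ≤ q := by exact_mod_cast hq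
    refine Dobro.moment_le_of_tail hf.measurable_supNorm (fun ω => Dobro.supNorm_nonneg (f ω))
      (hf.pos ⟨0, hq⟩) ?_ (mul_pos (by positivity) (Dobro.tailFactor_pos hD))
      (Dobro.log_mul_tailFactor_le hn hD hq hqn) hl htail
    rw [Real.log_mul (by positivity) (by positivity), Real.log_exp]
    nlinarith [Real.log_nonneg hD']
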